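/- **Setting.** Let $G$ be a finite two-player zero-sum extensive-form game with chance moves and perfect recall. Let $\Delta$ be its payoff range (largest minus smallest terminal payoff) and $|A|$ the largest number of actions at an information set. A *population* $\Pi$ is a choice of a nonempty set of available actions at every information set; the *restricted game* $G_\Pi$ is the game tree in which only the actions of $\Pi$ are available. Write $S_i(\Pi)$ for the set of information sets of player $i$ that occur in $G_\Pi$, $|A_i(\Pi)|$ for the largest number of available actions at one of them, and $X(\Pi)=\sum_i|S_i(\Pi)|$. *RMDO* with frequency function $m$ (positive integers $m(j)$, which may depend on the restricted game of window $j$): the initial population consists of pure best responses to the uniformly random strategy, and the first window has index $j=0$. Each iteration makes one iteration of counterfactual regret minimization (CFR with regret matching, simultaneous updates, started afresh in each window) in the current restricted game. Every $m(j)$ iterations of window $j$, pure best responses in $G$ to the current-window average strategy (the reach-weighted average of the CFR strategies, extended to $G$ by probability $0$) are added to the population, and if the population changes, window $j+1$ begins. The first iteration whose current-window average is an $\epsilon$-Nash equilibrium ($\epsilon$-NE) of $G$ is the iteration at which $\epsilon$-NE is reached; $k$ is then the number of windows so far, $X$ is the size $X(\Pi)$ of the last restricted game, and the sample complexity is the number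 of samples up to and including this iteration, where each CFR iteration and each best-response computation in a window with population $\Pi$ costs $X(\Pi)$ samples. *XDO* with initial threshold $\epsilon_0>0$ runs the same loop, but computes best responses in window $j$ as soon as the exploitability of the window average inside the restricted game is at most $\epsilon_0/2^j$; it stops when these best responses are already in the population, and outputs the window average. Put $$m^*(j)=\max\Big\{1,\Big\lceil 4^j\max_i|S_{i,j}|^2|A_{i,j}|/\epsilon_0^2\Big\rceil\Big\},$$ where $S_{i,j}=S_i(\Pi)$, $|A_{i,j}|=|A_i(\Pi)|$ for the population $\Pi$ of window $j$. **Proposition.** There is an absolute constant $C>0$ such that for every such game, every choice of best responses and every $\epsilon_0>0$, with $K=C\max\{1,\Delta^2\}$: 1. XDO stops, and its output is an $\epsilon_0/2^{k_0-1}$-NE, where $k_0$ is its number of windows. Until it stops, it coincides with RMDO for some frequency function $m$ with $1\le m(j)\le K\,m^*(j)$ for all $j$ and all populations. 2. For $0<\epsilon\le\Delta$, this instance of RMDO reaches $\epsilon$-NE with sample complexity at most $$K\Big(\frac{k|A|X^3}{\epsilon^2}+\frac{|A|X^3\,4^k}{\epsilon_0^2}\Big),$$ and so does XDO itself, no later than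 when it stops, if moreover $\epsilon_0/2^{k_0-1}\le\epsilon$. 3. For $0<\epsilon\le\Delta$, RMDO with the worst-case frequency function $m^*$ reaches $\epsilon$-NE with sample complexity at most the same bound. This also holds if the $m(j)$-divisibility test for best responses refers to the total number of iterations instead of the number of iterations in the window. 4. The sample count with $m^*$ is exponential in the number of windows: any initial stretch of the run of RMDO with frequency function $m^*$ whose last iteration lies in its $k$-th window, $k\ge2$, uses at least $4^k/(16\,\epsilon_0^2)$ samples. -/

import Mathlib

universe u v

/-- Finite two-player zero-sum game trees.  `S` is the type of information sets (of both players),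
`A s` the set of actions available at the information set `s`.  A terminal node carries the payoff
of player `0`; player `1` receives the opposite amount. -/
inductive GameTree (S : Type u) (A : S → Type v) : Type (max u v)
  | terminal (payoff : ℝ) : GameTree S A
  | chance (n : ℕ) (p : stdSimplex ℝ (Fin n)) (next : Fin n → GameTree S A) : GameTree S A
  | decision (s : S) (next : A s → GameTree S A) : GameTree S A

namespace GameTree

noncomputable section

/-- The set of payoffs (of player `0`) at terminal nodes. -/
def payoffs {S : Type u} {A : S → Type v} : GameTree S A → Set ℝ
  | terminal r => {r}
  | chance _ _ next => ⋃ c, (next c).payoffs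
  | decision _ next => ⋃ a, (next a).payoffs

/-- The payoff range `Δ`: largest minus smallest terminal payoff. -/
def payoffRange {S : Type u} {A : S → Type v} (G : GameTree S A) : ℝ :=
  Metric.diam G.payoffs

/-- `Reaches owner i G s l`: some history of `G` ends in a node of the information set `s`, and the
information sets and actions of player `i` met on the way are, in order, the list `l`. -/
inductive Reaches {S : Type u} {A : S → Type v} (owner : S → Fin 2) (i : Fin 2) :
    GameTree S A → S → List (Σ s, A s) → Prop
  | here (s : S) (next : A s → GameTree S A) : Reaches owner i (decision s next) s []
  | chance (n : ℕ) (p : stdSimplex ℝ (Fin n)) (next : Fin n → GameTree S A) (c : Fin n)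
      (s : S) (l : List (Σ s, A s)) (h : Reaches owner i (next c) s l) :
      Reaches owner i (chance n p next) s l
  | own (s' : S) (next : A s' → GameTree S A) (a : A s') (s : S) (l : List (Σ s, A s))
      (hs : owner s' = i) (h : Reaches owner i (next a) s l) :
      Reaches owner i (decision s' next) s (⟨s', a⟩ :: l)
  | other (s' : S) (next : A s' → GameTree S A) (a : A s') (s : S) (l : List (Σ s, A s))
      (hs : owner s' ≠ i) (h : Reaches owner i (next a) s l) :
      Reaches owner i (decision s' next) s l

/-- Perfect recall: all histories in an information set share the same sequence of earlier own
information sets and own actions. -/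
def PerfectRecall {S : Type u} {A : S → Type v} (owner : S → Fin 2) (G : GameTree S A) : Prop :=
  ∀ (s : S) (l l' : List (Σ s, A s)),
    Reaches owner (owner s) G s l → Reaches owner (owner s) G s l' → l = l'

/-- The information sets that occur in the tree. -/
def infosets {S : Type u} {A : S → Type v} [DecidableEq S] [∀ s, Fintype (A s)] :
    GameTree S A → Finset S
  | terminal _ => ∅
  | chance _ _ next => Finset.univ.biUnion fun c => (next c).infosets
  | decision s next => insert s (Finset.univ.biUnion fun a => (next a).infosets)

/-- The number `|S_i|` of information sets of player `i` that occur in the tree. -/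
def numInfosets {S : Type u} {A : S → Type v} [DecidableEq S] [∀ s, Fintype (A s)]
    (owner : S → Fin 2) (G : GameTree S A) (i : Fin 2) : ℕ :=
  (G.infosets.filter fun s => owner s = i).card

/-- The number `|A_i|`: the largest number of actions at an information set of player `i`. -/
def numActions {S : Type u} {A : S → Type v} [DecidableEq S] [∀ s, Fintype (A s)]
    (owner : S → Fin 2) (G : GameTree S A) (i : Fin 2) : ℕ :=
  (G.infosets.filter fun s => owner s = i).sup fun s => Fintype.card (A s)

/-- The size of the game, the total number of information sets of both players. -/
def size {S : Type u} {A : S → Type v} [DecidableEq S] [∀ s, Fintype (A s)]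
    (owner : S → Fin 2) (G : GameTree S A) : ℕ :=
  ∑ i, G.numInfosets owner i

/-- The number `|A|`: the largest number of actions at an information set of either player. -/
def maxActions {S : Type u} {A : S → Type v} [DecidableEq S] [∀ s, Fintype (A s)]
    (owner : S → Fin 2) (G : GameTree S A) : ℕ :=
  Finset.univ.sup fun i => G.numActions owner i

/-! ### Strategies, values, equilibria -/

/-- `π` is a joint behaviour strategy: `π s a` is the probability of action `a` at `s`; the strategy
of player `i` is the restriction of `π` to the information sets `s` with `owner s = i`. -/
def IsProfile {S : Type u} {A : S → Type v} [∀ s, Fintype (A s)] (π : ∀ s, A s → ℝ) : Prop :=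
  ∀ s, π s ∈ stdSimplex ℝ (A s)

/-- The uniformly random joint strategy. -/
def uniform {S : Type u} {A : S → Type v} [∀ s, Fintype (A s)] : ∀ s, A s → ℝ :=
  fun s _ => 1 / (Fintype.card (A s) : ℝ)

/-- The joint strategy playing a deterministic choice of actions. -/
def pure {S : Type u} {A : S → Type v} [∀ s, DecidableEq (A s)] (b : ∀ s, A s) : ∀ s, A s → ℝ :=
  fun s a => if a = b s then 1 else 0

/-- The joint strategy `(σ_i, π_{-i})`. -/
def deviate {S : Type u} {A : S → Type v} (owner : S → Fin 2) (i : Fin 2)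
    (σ π : ∀ s, A s → ℝ) : ∀ s, A s → ℝ :=
  fun s => if owner s = i then σ s else π s

/-- Expected payoff of player `0` when play starts at the root of the (sub)tree. -/
def value {S : Type u} {A : S → Type v} [∀ s, Fintype (A s)] (π : ∀ s, A s → ℝ) :
    GameTree S A → ℝ
  | terminal r => r
  | chance _ p next => ∑ c, (p : Fin _ → ℝ) c * value π (next c)
  | decision s next => ∑ a, π s a * value π (next a)

/-- `+1` for player `0` and `-1` for player `1`. -/
def sign (i : Fin 2) : ℝ := if i = 0 then 1 else -1

/-- Expected payoff `v_i(π)` of player `i`. -/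
def util {S : Type u} {A : S → Type v} [∀ s, Fintype (A s)] (G : GameTree S A) (i : Fin 2)
    (π : ∀ s, A s → ℝ) : ℝ :=
  sign i * G.value π

/-- `ε`-Nash equilibrium:
`min_{σ_{-i}} v_i(π_i, σ_{-i}) + ε ≥ v_i(π) ≥ max_{σ_i} v_i(σ_i, π_{-i}) - ε` for both players. -/
def IsNash {S : Type u} {A : S → Type v} [∀ s, Fintype (A s)] (owner : S → Fin 2)
    (G : GameTree S A) (ε : ℝ) (π : ∀ s, A s → ℝ) : Prop :=
  IsProfile π ∧ ∀ (i : Fin 2) (σ : ∀ s, A s → ℝ), IsProfile σ →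
    G.util i π ≤ G.util i (deviate owner i π σ) + ε ∧
    G.util i (deviate owner i σ π) - ε ≤ G.util i π

/-- Exploitability: the sum over the players of the gain from switching to a best response. -/
def exploitability {S : Type u} {A : S → Type v} [∀ s, Fintype (A s)] (owner : S → Fin 2)
    (G : GameTree S A) (π : ∀ s, A s → ℝ) : ℝ :=
  ⨆ σ : {σ : ∀ s, A s → ℝ // IsProfile σ},
    ∑ i, (G.util i (deviate owner i σ.1 π) - G.util i π)

/-- The pure strategy `b` of player `i` (only its values at `i`'s information sets matter) is a best
response against `π_{-i}`. -/
def IsBestResponse {S : Type u} {A : S → Type v} [∀ s, Fintype (A s)] [∀ s, DecidableEq (A s)]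
    (owner : S → Fin 2) (G : GameTree S A) (i : Fin 2) (π : ∀ s, A s → ℝ) (b : ∀ s, A s) : Prop :=
  ∀ σ : ∀ s, A s → ℝ, IsProfile σ →
    G.util i (deviate owner i σ π) ≤ G.util i (deviate owner i (pure b) π)

/-! ### Counterfactual regret minimization -/

/-- Instantaneous counterfactual regret at the information set `s`, with `i = owner s`:
`∑_{h ∈ s} x_{-i}(h) (v_i(h·a) - v_i(h))`, where `x_{-i}(h)` is the contribution of chance and of the
opponent to the probability of `h`, and `v_i(h)` is the expected payoff when play starts at `h`. -/
def instRegret {S : Type u} {A : S → Type v} [DecidableEq S] [∀ s, Fintype (A s)]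
    (owner : S → Fin 2) (π : ∀ s, A s → ℝ) (s : S) (a : A s) : GameTree S A → ℝ
  | terminal _ => 0
  | chance _ p next => ∑ c, (p : Fin _ → ℝ) c * instRegret owner π s a (next c)
  | decision s' next =>
      (if h : s = s' then
        util (next (h ▸ a)) (owner s) π - util (decision s' next) (owner s) π
      else 0) +
      ∑ b, (if owner s' = owner s then 1 else π s' b) * instRegret owner π s a (next b)

/-- Regret matching: probabilities proportional to positive parts of the regrets, and uniform
probabilities if no regret is positive. -/
def regretMatching {S : Type u} {A : S → Type v} [∀ s, Fintype (A s)] (R : ∀ s, A s → ℝ) :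
    ∀ s, A s → ℝ :=
  fun s a => if 0 < ∑ b, max 0 (R s b) then max 0 (R s a) / ∑ b, max 0 (R s b)
    else 1 / (Fintype.card (A s) : ℝ)

/-- Cumulative counterfactual regrets after `n` iterations of CFR started from scratch. -/
def cfrRegret {S : Type u} {A : S → Type v} [DecidableEq S] [∀ s, Fintype (A s)]
    (owner : S → Fin 2) (G : GameTree S A) : ℕ → ∀ s, A s → ℝ
  | 0 => fun _ _ => 0
  | n + 1 => fun s a => cfrRegret owner G n s a +
      instRegret owner (regretMatching (cfrRegret owner G n)) s a G

/-- The joint strategy that CFR uses in its `(n + 1)`-st iteration; for `n = 0` it is uniform. -/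
def cfrStrategy {S : Type u} {A : S → Type v} [DecidableEq S] [∀ s, Fintype (A s)]
    (owner : S → Fin 2) (G : GameTree S A) (n : ℕ) : ∀ s, A s → ℝ :=
  regretMatching (cfrRegret owner G n)

/-- `∑_{h ∈ s} x_i(h)` with `i = owner s`, where `x_i(h)` is the contribution of player `i` to the
probability of `h`. -/
def ownReach {S : Type u} {A : S → Type v} [DecidableEq S] [∀ s, Fintype (A s)]
    (owner : S → Fin 2) (π : ∀ s, A s → ℝ) (s : S) : GameTree S A → ℝ
  | terminal _ => 0
  | chance _ _ next => ∑ c, ownReach owner π s (next c)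
  | decision s' next => (if s = s' then 1 else 0) +
      ∑ b, (if owner s' = owner s then π s' b else 1) * ownReach owner π s (next b)

/-- The average strategy of the first `n` iterations of CFR.  As always for behaviour strategies, the
average at `s` is weighted by the probability with which the player of `s` plays to reach `s` (so
that the average strategy is realization equivalent to playing one of the `n` strategies at
random); it is uniform where all weights vanish. -/
def cfrAverage {S : Type u} {A : S → Type v} [DecidableEq S] [∀ s, Fintype (A s)]
    (owner : S → Fin 2) (G : GameTree S A) (n : ℕ) : ∀ s, A s → ℝ :=
  fun s a =>
    if 0 < ∑ t ∈ Finset.range n, ownReach owner (cfrStrategy owner G t) s G then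
      (∑ t ∈ Finset.range n,
        ownReach owner (cfrStrategy owner G t) s G * cfrStrategy owner G t s a) /
        ∑ t ∈ Finset.range n, ownReach owner (cfrStrategy owner G t) s G
    else 1 / (Fintype.card (A s) : ℝ)

end

end GameTree

/-! ### Populations and restricted games -/

/-- A population: the actions available in the restricted game, at least one at each information
set (populations consist of full pure strategies). -/
@[ext] structure Population {S : Type u} (A : S → Type v) where
  acts : ∀ s, Finset (A s)
  nonempty : ∀ s, (acts s).Nonempty

namespace Population

noncomputable section

/-- Joint strategies of a restricted game, extended to the original game by probability zero. -/
def extend {S : Type u} {A : S → Type v} [∀ s, DecidableEq (A s)] (P : Population A)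
    (π : ∀ s, P.acts s → ℝ) : ∀ s, A s → ℝ :=
  fun s a => if h : a ∈ P.acts s then π s ⟨a, h⟩ else 0

/-- The restricted game: the game tree in which only actions of the population are available. -/
def restrict {S : Type u} {A : S → Type v} (P : Population A) :
    GameTree S A → GameTree S (fun s => P.acts s)
  | .terminal r => .terminal r
  | .chance n p next => .chance n p fun c => restrict P (next c)
  | .decision s next => .decision s fun a => restrict P (next a)

/-- The population that contains one joint pure strategy. -/
def single {S : Type u} {A : S → Type v} (b : ∀ s, A s) : Population A where
  acts s := {b s}
  nonempty s := Finset.singleton_nonempty (b s)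

/-- Adding a joint pure strategy to a population. -/
def add {S : Type u} {A : S → Type v} [∀ s, DecidableEq (A s)] (P : Population A)
    (b : ∀ s, A s) : Population A where
  acts s := insert (b s) (P.acts s)
  nonempty s := Finset.insert_nonempty (b s) (P.acts s)

end

end Population

/-! ### Double oracle with regret minimization -/

namespace DoubleOracle

noncomputable section

/-- State between two iterations: index of the current time window (starting from `0`), current
population, and number of CFR iterations already made in the current window.  (CFR is deterministic
and restarts in each window, so its regrets and strategies are functions of these data.) -/
@[ext] structure State {S : Type u} (A : S → Type v) where
  win : ℕ
  pop : Population A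
  iters : ℕ

/-- A best-response oracle `β` returns for each player and joint strategy a pure best response. -/
def IsOracle {S : Type u} {A : S → Type v} [∀ s, Fintype (A s)] [∀ s, DecidableEq (A s)]
    (owner : S → Fin 2) (G : GameTree S A)
    (β : Fin 2 → (∀ s, A s → ℝ) → ∀ s, A s) : Prop :=
  ∀ (i : Fin 2) (π : ∀ s, A s → ℝ), GameTree.IsProfile π → G.IsBestResponse owner i π (β i π)

/-- The pair of best responses returned by the oracle, as one joint pure strategy. -/
def jointResponse {S : Type u} {A : S → Type v} (owner : S → Fin 2)
    (β : Fin 2 → (∀ s, A s → ℝ) → ∀ s, A s) (π : ∀ s, A s → ℝ) : ∀ s, A s :=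
  fun s => β (owner s) π s

/-- The current-window average strategy in the restricted game, after the iteration of CFR that is
made from the state `x`. -/
def localAverage {S : Type u} {A : S → Type v} [DecidableEq S]
    (owner : S → Fin 2) (G : GameTree S A) (x : State A) : ∀ s, x.pop.acts s → ℝ :=
  (x.pop.restrict G).cfrAverage owner (x.iters + 1)

/-- The same average strategy, expanded to the original game (last-window average strategy). -/
def windowAverage {S : Type u} {A : S → Type v} [DecidableEq S] [∀ s, DecidableEq (A s)]
    (owner : S → Fin 2) (G : GameTree S A) (x : State A) : ∀ s, A s → ℝ :=
  x.pop.extend (localAverage owner G x)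

/-- The population enlarged by best responses against the window average strategy. -/
def enlarged {S : Type u} {A : S → Type v} [DecidableEq S] [∀ s, DecidableEq (A s)]
    (owner : S → Fin 2) (G : GameTree S A) (β : Fin 2 → (∀ s, A s → ℝ) → ∀ s, A s)
    (x : State A) : Population A :=
  x.pop.add (jointResponse owner β (windowAverage owner G x))

open Classical in
/-- One iteration: one iteration of CFR in the restricted game; then, if `call` holds, best responses
against the window average are added to the population; if the population changes, a new window is
started and CFR is reset. -/
def step {S : Type u} {A : S → Type v} [DecidableEq S] [∀ s, DecidableEq (A s)]
    (owner : S → Fin 2) (G : GameTree S A) (β : Fin 2 → (∀ s, A s → ℝ) → ∀ s, A s)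
    (call : Prop) (x : State A) : State A :=
  if call ∧ enlarged owner G β x ≠ x.pop then
    { win := x.win + 1, pop := enlarged owner G β x, iters := 0 }
  else { x with iters := x.iters + 1 }

/-- The state after `t` iterations.  `call t x` tells whether best responses are computed in iteration
`t` (iterations are numbered `1, 2, …`) when `x` is the state before that iteration.  The initial
population consists of best responses against the uniformly random strategy. -/
def run {S : Type u} {A : S → Type v} [DecidableEq S] [∀ s, Fintype (A s)]
    [∀ s, DecidableEq (A s)] (owner : S → Fin 2) (G : GameTree S A)
    (β : Fin 2 → (∀ s, A s → ℝ) → ∀ s, A s) (call : ℕ → State A → Prop) : ℕ → State A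
  | 0 => { win := 0, pop := Population.single (jointResponse owner β GameTree.uniform), iters := 0 }
  | t + 1 => step owner G β (call (t + 1) (run owner G β call t)) (run owner G β call t)

/-- Which clock the test "`m(j)` divides the time" of RMDO refers to: the total number of
iterations, or the number of iterations in the current window. -/
inductive Clock
  | total
  | window

/-- RMDO with frequency function `m`: best responses are computed every `m(j)` iterations in window
`j`.  (`m j P` may depend on the restricted game `P` of window `j`.) -/
def rmdo {S : Type u} {A : S → Type v} (clock : Clock) (m : ℕ → Population A → ℕ) :
    ℕ → State A → Prop :=
  fun t x => m x.win x.pop ∣ (match clock with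
    | .total => t
    | .window => x.iters + 1)

/-- XDO with initial threshold `ε₀`, halved from each window to the next: best responses are computed
when the exploitability of the window average in the restricted game is at most the threshold. -/
def xdo {S : Type u} {A : S → Type v} [DecidableEq S]
    (owner : S → Fin 2) (G : GameTree S A) (ε₀ : ℝ) : ℕ → State A → Prop :=
  fun _ x => (x.pop.restrict G).exploitability owner (localAverage owner G x) ≤ ε₀ / 2 ^ x.win

/-- Convergence in iteration `t + 1`: best responses are computed and all of them are already in the
population.  XDO then stops and outputs the window average strategy. -/
def ConvergedAt {S : Type u} {A : S → Type v} [DecidableEq S] [∀ s, Fintype (A s)]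
    [∀ s, DecidableEq (A s)] (owner : S → Fin 2) (G : GameTree S A)
    (β : Fin 2 → (∀ s, A s → ℝ) → ∀ s, A s) (call : ℕ → State A → Prop) (t : ℕ) : Prop :=
  call (t + 1) (run owner G β call t) ∧
    enlarged owner G β (run owner G β call t) = (run owner G β call t).pop

/-- Iteration `t + 1` is the first one whose last-window average strategy is an `ε`-Nash equilibrium
of the original game. -/
def FirstNash {S : Type u} {A : S → Type v} [DecidableEq S] [∀ s, Fintype (A s)]
    [∀ s, DecidableEq (A s)] (owner : S → Fin 2) (G : GameTree S A)
    (β : Fin 2 → (∀ s, A s → ℝ) → ∀ s, A s) (call : ℕ → State A → Prop) (ε : ℝ) (t : ℕ) : Prop :=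
  IsLeast {τ : ℕ | G.IsNash owner ε (windowAverage owner G (run owner G β call τ))} t

/-- Size of the restricted game of a state, the number of information sets occurring in it. -/
def restrictedSize {S : Type u} {A : S → Type v} [DecidableEq S]
    (owner : S → Fin 2) (G : GameTree S A) (x : State A) : ℕ :=
  (x.pop.restrict G).size owner

open Classical in
/-- Sample count of the first `t` iterations: each CFR iteration and each computation of best responses
costs as many samples as there are information sets in the current restricted game. -/
def samples {S : Type u} {A : S → Type v} [DecidableEq S] [∀ s, Fintype (A s)]
    [∀ s, DecidableEq (A s)] (owner : S → Fin 2) (G : GameTree S A)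
    (β : Fin 2 → (∀ s, A s → ℝ) → ∀ s, A s) (call : ℕ → State A → Prop) (t : ℕ) : ℕ :=
  ∑ τ ∈ Finset.range t,
    (restrictedSize owner G (run owner G β call τ) +
      if call (τ + 1) (run owner G β call τ) then restrictedSize owner G (run owner G β call τ)
      else 0)

/-- The worst-case frequency function of XDO, `m(j) = 4^j max_i |S_{i,j}|² |A_{i,j}| / ε₀²`, rounded up
to a positive integer. -/
def xdoFrequency {S : Type u} {A : S → Type v} [DecidableEq S]
    (owner : S → Fin 2) (G : GameTree S A) (ε₀ : ℝ) (j : ℕ) (P : Population A) : ℕ :=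
  max 1 ⌈4 ^ j * ((Finset.univ.sup fun i : Fin 2 =>
    (P.restrict G).numInfosets owner i ^ 2 * (P.restrict G).numActions owner i : ℕ) : ℝ)
      / ε₀ ^ 2⌉₊

/-- `k |A| X³ / ε² + |A| X³ 4^k / ε₀²`. -/
def xdoBound (k a X : ℕ) (ε ε₀ : ℝ) : ℝ :=
  k * a * X ^ 3 / ε ^ 2 + a * X ^ 3 * 4 ^ k / ε₀ ^ 2

/-- Iteration `T + 1` is the first one whose last-window average strategy is an `ε`-Nash equilibrium, and
the samples used up to and including it number at most
`K (k |A| X³ / ε² + |A| X³ 4^k / ε₀²)`, where `k` is the number of windows so far and `X` is the size of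
the restricted game of the last of them. -/
def ReachesWithin {S : Type u} {A : S → Type v} [DecidableEq S] [∀ s, Fintype (A s)]
    [∀ s, DecidableEq (A s)] (owner : S → Fin 2) (G : GameTree S A)
    (β : Fin 2 → (∀ s, A s → ℝ) → ∀ s, A s) (call : ℕ → State A → Prop) (K ε ε₀ : ℝ) (T : ℕ) :
    Prop :=
  FirstNash owner G β call ε T ∧
    (samples owner G β call (T + 1) : ℝ) ≤
      K * xdoBound ((run owner G β call T).win + 1) (G.maxActions owner)
        (restrictedSize owner G (run owner G β call T)) ε ε₀

end

end DoubleOracle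

/-!
The proof combines the regret bound of CFR in a fixed restricted game with a count of the iterations
in each window.

*Regret.* Along the tree, the gain of a deviation telescopes into counterfactual regrets, weighted by
the probabilities with which the deviating player plays to reach the information sets
(`mul_util_deviate_sub_util`); by perfect recall these weights are functions of the information set.
The same hypothesis bounds every counterfactual regret by the payoff range `Δ`
(`abs_instRegret_le`), and then the Blackwell argument for regret matching bounds the cumulative
regrets after `n` iterations by `Δ √(n |A_i|)` (`cfrRegret_le`). The reach-weighted average strategy is
realization equivalent to the uniform mixture of the iterates (`sum_value_deviate_cfrStrategy`), so
with `M = max_i |S_i|² |A_i|` its exploitability is at most `δ` once `n ≥ 4 Δ² M / δ²`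
(`exploitability_cfrAverage_le`).

*Windows.* If best responses against the window average are already available, then the average is as
close to equilibrium in `G` as in the restricted game (`Population.isNash_extend`). Hence a call of
the oracle that neither changes the population nor meets an `ε`-equilibrium happens before iteration
`4 Δ² M / ε²` of its window, and as calls are `m` iterations apart, with either clock, a window
lasts at most `m + 4 Δ² M / ε²` iterations (`iters_rmdo_le`). Each new window enlarges the population,
so there are finitely many. Since `M ≤ |A| X²` and the restricted games grow, summing the geometric
series in `4 ^ j` over the windows and multiplying by the cost `2 X` of an iteration gives the sample
complexity for every frequency function of the order of `m*` (`exists_reachesWithin_rmdo`); the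
condition `ε ≤ Δ` absorbs the rounding of the frequencies.

*XDO.* Until XDO stops, every call of the oracle opens a new window, so a window ends with its first
call. Thus XDO is RMDO for the frequency `xdoPeriod`, the first iteration at which the threshold is
met, and the regret bound gives `xdoPeriod ≤ 4 Δ² 4 ^ j M / ε₀² + 1`.

*Lower bound.* With `m*`, already the last completed window, of index `k - 2`, takes
`m* ≥ 4 ^ (k - 2) / ε₀²` iterations, each of which costs at least one sample
(`le_samples_rmdo_window`).
-/

namespace GameTree

/-! ### Finite weighted sums and bounds on values -/

section Basic

variable {S : Type u} {A : S → Type v}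

theorem abs_sum_mul_le_of_mem_stdSimplex {ι : Type*} [Fintype ι] {w x : ι → ℝ} {D : ℝ}
    (hw : w ∈ stdSimplex ℝ ι) (hx : ∀ j, |x j| ≤ D) : |∑ j, w j * x j| ≤ D := by
  calc |∑ j, w j * x j| ≤ ∑ j, |w j * x j| := Finset.abs_sum_le_sum_abs _ _
    _ ≤ ∑ j, w j * D := by
        refine Finset.sum_le_sum fun j _ => ?_
        rw [abs_mul, abs_of_nonneg (hw.1 j)]
        exact mul_le_mul_of_nonneg_left (hx j) (hw.1 j)
    _ = D := by rw [← Finset.sum_mul, hw.2, one_mul]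

theorem sum_mul_mem_Icc_of_mem_stdSimplex {ι : Type*} [Fintype ι] {w x : ι → ℝ} {lo hi : ℝ}
    (hw : w ∈ stdSimplex ℝ ι) (hx : ∀ j, x j ∈ Set.Icc lo hi) :
    ∑ j, w j * x j ∈ Set.Icc lo hi :=
  (convex_Icc lo hi).sum_mem (fun j _ => hw.1 j) hw.2 fun j _ => hx j

theorem value_mem_Icc [∀ s, Fintype (A s)] {π : ∀ s, A s → ℝ} (hπ : IsProfile π) {lo hi : ℝ}
    (H : GameTree S A) (h : H.payoffs ⊆ Set.Icc lo hi) : H.value π ∈ Set.Icc lo hi := by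
  induction H with
  | terminal r => exact h rfl
  | chance n p next ih =>
    exact sum_mul_mem_Icc_of_mem_stdSimplex p.2
      fun c => ih c ((Set.subset_iUnion (fun c => (next c).payoffs) c).trans h)
  | decision s next ih =>
    exact sum_mul_mem_Icc_of_mem_stdSimplex (hπ s)
      fun a => ih a ((Set.subset_iUnion (fun a => (next a).payoffs) a).trans h)

theorem finite_payoffs [∀ s, Fintype (A s)] (H : GameTree S A) : H.payoffs.Finite := by
  induction H with
  | terminal r => exact Set.finite_singleton r
  | chance n p next ih => exact Set.finite_iUnion ih
  | decision s next ih => exact Set.finite_iUnion ih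

theorem exists_payoffs_subset_Icc [∀ s, Fintype (A s)] (H : GameTree S A) :
    ∃ lo, H.payoffs ⊆ Set.Icc lo (lo + H.payoffRange) := by
  have hb := H.finite_payoffs.isBounded
  refine ⟨sInf H.payoffs, fun x hx => ⟨csInf_le hb.bddBelow hx, ?_⟩⟩
  rw [payoffRange, Real.diam_eq hb, add_sub_cancel]
  exact le_csSup hb.bddAbove hx

theorem payoffRange_nonneg (H : GameTree S A) : 0 ≤ H.payoffRange := Metric.diam_nonneg

theorem abs_sign (i : Fin 2) : |sign i| = 1 := by
  unfold sign; split_ifs <;> norm_num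

theorem IsProfile.deviate {owner : S → Fin 2} {i : Fin 2} [∀ s, Fintype (A s)]
    {σ π : ∀ s, A s → ℝ} (hσ : IsProfile σ) (hπ : IsProfile π) :
    IsProfile (deviate owner i σ π) := by
  intro s
  unfold GameTree.deviate
  split_ifs
  exacts [hσ s, hπ s]

theorem abs_util_sub_util_le [∀ s, Fintype (A s)] {π ρ : ∀ s, A s → ℝ} (hπ : IsProfile π)
    (hρ : IsProfile ρ) {lo hi : ℝ} {H K : GameTree S A} (hH : H.payoffs ⊆ Set.Icc lo hi)
    (hK : K.payoffs ⊆ Set.Icc lo hi) (i : Fin 2) :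
    |H.util i π - K.util i ρ| ≤ hi - lo := by
  have h1 := value_mem_Icc hπ H hH
  have h2 := value_mem_Icc hρ K hK
  rw [util, util, ← mul_sub, abs_mul, abs_sign, one_mul, abs_le]
  constructor <;> linarith [h1.1, h1.2, h2.1, h2.2]

end Basic

/-! ### Own sequences and perfect recall -/

section Recall

variable {S : Type u} {A : S → Type v} {owner : S → Fin 2} {i : Fin 2}

/-- The probability that `π` plays all the actions of the list `l` of information sets and
actions. -/
noncomputable def seqProb (π : ∀ s, A s → ℝ) (l : List (Σ s, A s)) : ℝ :=
  (l.map fun x => π x.1 x.2).prod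

/-- `W s` is the probability with which player `i` plays to reach each of the nodes of `H` that lie
in the information set `s` of player `i`, where `H` is a subtree that player `i` plays to reach with
probability `c`. -/
def IsOwnReach (owner : S → Fin 2) (i : Fin 2) (π : ∀ s, A s → ℝ) (H : GameTree S A) (c : ℝ)
    (W : S → ℝ) : Prop :=
  ∀ s l, owner s = i → Reaches owner i H s l → W s = c * seqProb π l

theorem IsOwnReach.chance {π : ∀ s, A s → ℝ} {n : ℕ} {p : stdSimplex ℝ (Fin n)}
    {next : Fin n → GameTree S A} {c : ℝ} {W : S → ℝ}
    (h : IsOwnReach owner i π (.chance n p next) c W) (j : Fin n) :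
    IsOwnReach owner i π (next j) c W :=
  fun s l hs hl => h s l hs (.chance n p next j s l hl)

theorem IsOwnReach.other {π : ∀ s, A s → ℝ} {s' : S} {next : A s' → GameTree S A} {c : ℝ}
    {W : S → ℝ} (h : IsOwnReach owner i π (.decision s' next) c W) (hs' : owner s' ≠ i)
    (b : A s') : IsOwnReach owner i π (next b) c W :=
  fun s l hs hl => h s l hs (.other s' next b s l hs' hl)

theorem IsOwnReach.own {π : ∀ s, A s → ℝ} {s' : S} {next : A s' → GameTree S A} {c : ℝ}
    {W : S → ℝ} (h : IsOwnReach owner i π (.decision s' next) c W) (hs' : owner s' = i)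
    (b : A s') : IsOwnReach owner i π (next b) (c * π s' b) W := by
  intro s l hs hl
  rw [h s _ hs (.own s' next b s l hs' hl)]
  simp [seqProb, mul_assoc]

theorem IsOwnReach.root {π : ∀ s, A s → ℝ} {s' : S} {next : A s' → GameTree S A} {c : ℝ}
    {W : S → ℝ} (h : IsOwnReach owner i π (.decision s' next) c W) (hs' : owner s' = i) :
    W s' = c := by
  rw [h s' [] hs' (.here s' next)]
  simp [seqProb]

theorem seqProb_mem_Icc [∀ s, Fintype (A s)] {π : ∀ s, A s → ℝ} (hπ : IsProfile π)
    (l : List (Σ s, A s)) : seqProb π l ∈ Set.Icc (0 : ℝ) 1 := by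
  induction l with
  | nil => simp [seqProb]
  | cons x l ih =>
    have h0 := (hπ x.1).1 x.2
    have h1 : π x.1 x.2 ≤ 1 :=
      (Finset.single_le_sum (fun a _ => (hπ x.1).1 a) (Finset.mem_univ x.2)).trans_eq (hπ x.1).2
    have : seqProb π (x :: l) = π x.1 x.2 * seqProb π l := by simp [seqProb]
    rw [this]
    exact ⟨mul_nonneg h0 ih.1, mul_le_one₀ h1 ih.1 ih.2⟩

/-- Perfect recall makes the own reach probability of an information set well defined. -/
theorem PerfectRecall.exists_isOwnReach [∀ s, Fintype (A s)] {G : GameTree S A}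
    (hG : G.PerfectRecall owner) (i : Fin 2) :
    ∃ W : (∀ s, A s → ℝ) → S → ℝ, ∀ π, IsProfile π →
      IsOwnReach owner i π G 1 (W π) ∧ ∀ s, W π s ∈ Set.Icc (0 : ℝ) 1 := by
  classical
  refine ⟨fun π s => if h : ∃ l, Reaches owner i G s l then seqProb π h.choose else 0,
    fun π hπ => ⟨?_, ?_⟩⟩
  · intro s l hs hl
    have h : ∃ l, Reaches owner i G s l := ⟨l, hl⟩
    subst hs
    simp only [dif_pos h, one_mul]
    rw [hG s _ _ h.choose_spec hl]
  · intro s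
    dsimp only
    split_ifs
    · exact seqProb_mem_Icc hπ _
    · simp

end Recall

/-! ### Counterfactual regrets -/

section Regret

variable {S : Type u} {A : S → Type v} [DecidableEq S] [∀ s, Fintype (A s)]
  {owner : S → Fin 2} {i : Fin 2}

/-- The gain of a deviation is the sum of the counterfactual regrets, weighted by the probabilities
with which the deviating strategy plays them.  This is a telescoping sum along the tree; perfect
recall enters only through the well-defined weights `W`. -/
theorem mul_util_deviate_sub_util [Fintype S] {σ π : ∀ s, A s → ℝ} (hσ : IsProfile σ)
    (H : GameTree S A) {c : ℝ} {W : S → ℝ} (hW : IsOwnReach owner i σ H c W) :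
    c * (H.util i (deviate owner i σ π) - H.util i π) =
      ∑ s with owner s = i, W s * ∑ a, σ s a * instRegret owner π s a H := by
  induction H generalizing c with
  | terminal r => simp [util, value, instRegret]
  | chance n p next ih =>
    have h1 : ∀ ρ : ∀ s, A s → ℝ, (chance n p next).util i ρ =
        ∑ j, (p : Fin n → ℝ) j * (next j).util i ρ := by
      intro ρ
      simp only [util, value, Finset.mul_sum]
      exact Finset.sum_congr rfl fun j _ => by ring
    rw [h1, h1, ← Finset.sum_sub_distrib, Finset.mul_sum]
    have h2 : ∀ j, c * ((p : Fin n → ℝ) j * (next j).util i (deviate owner i σ π) -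
        (p : Fin n → ℝ) j * (next j).util i π) = (p : Fin n → ℝ) j *
          ∑ s with owner s = i, W s * ∑ a, σ s a * instRegret owner π s a (next j) := by
      intro j
      rw [← ih j (hW.chance j)]; ring
    simp only [h2, instRegret, Finset.mul_sum]
    rw [Finset.sum_comm]
    refine Finset.sum_congr rfl fun s _ => ?_
    rw [Finset.sum_comm]
    refine Finset.sum_congr rfl fun a _ => Finset.sum_congr rfl fun j _ => by ring
  | decision s' next ih =>
    have h1 : ∀ ρ : ∀ s, A s → ℝ, (decision s' next).util i ρ =
        ∑ b, ρ s' b * (next b).util i ρ := by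
      intro ρ
      simp only [util, value, Finset.mul_sum]
      exact Finset.sum_congr rfl fun j _ => by ring
    -- the counterfactual regret splits into the part of the root and the part of the children
    have h3 : ∑ s with owner s = i, W s * ∑ a, σ s a * instRegret owner π s a (decision s' next) =
        (if owner s' = i then
          W s' * ∑ a, σ s' a * ((next a).util i π - (decision s' next).util i π) else 0) +
        ∑ b, (if owner s' = i then 1 else π s' b) *
          ∑ s with owner s = i, W s * ∑ a, σ s a * instRegret owner π s a (next b) := by
      have e1 : ∀ s ∈ Finset.univ.filter (fun s => owner s = i),
          W s * ∑ a, σ s a * instRegret owner π s a (decision s' next) =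
          (if h : s = s' then
            W s' * ∑ a, σ s' a * ((next a).util i π - (decision s' next).util i π) else 0) +
          ∑ b, (if owner s' = i then 1 else π s' b) *
            (W s * ∑ a, σ s a * instRegret owner π s a (next b)) := by
        intro s hs
        have hs : owner s = i := (Finset.mem_filter.1 hs).2
        simp only [instRegret, hs, mul_add, Finset.sum_add_distrib]
        congr 1
        · by_cases h : s = s'
          · subst h; simp
          · simp [h]
        · simp only [Finset.mul_sum]
          rw [Finset.sum_comm]
          refine Finset.sum_congr rfl fun a _ => Finset.sum_congr rfl fun j _ => by ring
      rw [Finset.sum_congr rfl e1, Finset.sum_add_distrib]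
      congr 1
      · by_cases h : owner s' = i
        · rw [if_pos h, Finset.sum_eq_single s']
          · simp
          · intro s _ hs; simp [hs]
          · intro h'; simp [h] at h'
        · rw [if_neg h]
          refine Finset.sum_eq_zero fun s hs => ?_
          rw [dif_neg]
          rintro rfl
          exact h (Finset.mem_filter.1 hs).2
      · rw [Finset.sum_comm]
        exact Finset.sum_congr rfl fun b _ => by rw [Finset.mul_sum]
    rw [h3]
    by_cases h : owner s' = i
    · simp only [h, if_true, one_mul]
      have h2 := fun b => ih b (hW.own h b)
      simp only [← h2, hW.root h, mul_sub, Finset.sum_sub_distrib, ← Finset.sum_mul, (hσ s').2]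
      rw [h1 (deviate owner i σ π)]
      simp only [deviate, h, if_true, Finset.mul_sum]
      simp only [mul_assoc]
      ring
    · simp only [h, if_false, zero_add]
      have h2 := fun b => ih b (hW.other h b)
      rw [h1, h1, ← Finset.sum_sub_distrib, Finset.mul_sum]
      refine Finset.sum_congr rfl fun b _ => ?_
      rw [← h2]
      simp only [deviate, h, if_false]
      ring

theorem sum_mul_instRegret {π : ∀ s, A s → ℝ} (hπ : IsProfile π) (s : S) (H : GameTree S A) :
    ∑ a, π s a * instRegret owner π s a H = 0 := by
  induction H with
  | terminal r => simp [instRegret]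
  | chance n p next ih =>
    simp only [instRegret, Finset.mul_sum]
    rw [Finset.sum_comm]
    refine Finset.sum_eq_zero fun j _ => ?_
    simp only [mul_left_comm (π s _)]
    rw [← Finset.mul_sum, ih j, mul_zero]
  | decision s' next ih =>
    simp only [instRegret, mul_add, Finset.sum_add_distrib]
    have h1 : ∑ a, π s a * ∑ b, (if owner s' = owner s then 1 else π s' b) *
        instRegret owner π s a (next b) = 0 := by
      simp only [Finset.mul_sum]
      rw [Finset.sum_comm]
      refine Finset.sum_eq_zero fun b _ => ?_
      simp only [mul_left_comm (π s _)]
      rw [← Finset.mul_sum, ih b, mul_zero]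
    rw [h1, add_zero]
    by_cases h : s = s'
    · subst h
      simp only [dite_true, mul_sub, Finset.sum_sub_distrib, ← Finset.sum_mul, (hπ s).2, one_mul]
      simp only [util, value, Finset.mul_sum]
      rw [sub_eq_zero]
      exact Finset.sum_congr rfl fun a _ => by ring
    · simp [h]

theorem instRegret_eq_zero {π : ∀ s, A s → ℝ} {s : S} {a : A s} (H : GameTree S A)
    (h : ∀ l, ¬ Reaches owner (owner s) H s l) : instRegret owner π s a H = 0 := by
  induction H with
  | terminal r => rfl
  | chance n p next ih =>
    refine Finset.sum_eq_zero fun j _ => ?_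
    rw [ih j fun l hl => h l (.chance n p next j s l hl), mul_zero]
  | decision s' next ih =>
    have hs : s ≠ s' := by
      rintro rfl
      exact h [] (.here s next)
    rw [instRegret, dif_neg hs, zero_add]
    refine Finset.sum_eq_zero fun b _ => ?_
    rw [ih b, mul_zero]
    intro l hl
    by_cases ho : owner s' = owner s
    · exact h _ (.own s' next b s l ho hl)
    · exact h _ (.other s' next b s l ho hl)

/-- Under perfect recall, chance and the opponent reach the nodes of one information set with total
probability at most one, so a counterfactual regret never exceeds the range of the payoffs. -/
theorem abs_instRegret_le {π : ∀ s, A s → ℝ} (hπ : IsProfile π) {lo hi : ℝ} (hlo : lo ≤ hi)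
    {s : S} {a : A s} (H : GameTree S A) (hH : H.payoffs ⊆ Set.Icc lo hi)
    {l₀ : List (Σ s, A s)} (h : ∀ l, Reaches owner (owner s) H s l → l = l₀) :
    |instRegret owner π s a H| ≤ hi - lo := by
  have hD : 0 ≤ hi - lo := sub_nonneg.2 hlo
  induction H generalizing l₀ with
  | terminal r => simpa [instRegret] using hlo
  | chance n p next ih =>
    exact abs_sum_mul_le_of_mem_stdSimplex p.2
      fun j => ih j ((Set.subset_iUnion (fun c => (next c).payoffs) j).trans hH)
        fun l hl => h l (.chance n p next j s l hl)
  | decision s' next ih =>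
    have hsub : ∀ b, (next b).payoffs ⊆ Set.Icc lo hi :=
      fun b => (Set.subset_iUnion (fun c => (next c).payoffs) b).trans hH
    by_cases hs : s = s'
    · subst hs
      have hnil : [] = l₀ := h [] (.here s next)
      have h0 : ∀ b, instRegret owner π s a (next b) = 0 := by
        refine fun b => instRegret_eq_zero _ fun l hl => ?_
        have := h _ (.own s next b s l rfl hl)
        simp [← hnil] at this
      rw [instRegret, dif_pos rfl]
      simp only [h0, mul_zero, Finset.sum_const_zero, add_zero]
      exact abs_util_sub_util_le hπ hπ (hsub _) hH _
    · rw [instRegret, dif_neg hs, zero_add]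
      by_cases ho : owner s' = owner s
      · simp only [ho, if_true, one_mul]
        by_cases hex : ∃ b l, Reaches owner (owner s) (next b) s l
        · obtain ⟨b, l, hl⟩ := hex
          have hb := h _ (.own s' next b s l ho hl)
          rw [Finset.sum_eq_single b]
          · refine ih b (hsub b) (l₀ := l) fun l' hl' => ?_
            have := h _ (.own s' next b s l' ho hl')
            rw [← hb] at this
            simpa using this
          · intro b' _ hne
            refine instRegret_eq_zero _ fun l' hl' => hne ?_
            have := h _ (.own s' next b' s l' ho hl')
            rw [← hb] at this
            simp only [List.cons.injEq, Sigma.mk.injEq, true_and] at this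
            exact eq_of_heq this.1
          · simp
        · push Not at hex
          rw [Finset.sum_eq_zero fun b _ => instRegret_eq_zero _ (hex b)]
          simpa using hlo
      · simp only [ho, if_false]
        exact abs_sum_mul_le_of_mem_stdSimplex (hπ s')
          fun b => ih b (hsub b) fun l hl => h l (.other s' next b s l ho hl)

theorem mem_infosets_of_reaches {H : GameTree S A} {s : S} {l : List (Σ s, A s)}
    (h : Reaches owner i H s l) : s ∈ H.infosets := by
  induction h with
  | here s next => simp [infosets]
  | chance n p next c s l h ih =>
    simp only [infosets, Finset.mem_biUnion, Finset.mem_univ, true_and]; exact ⟨c, ih⟩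
  | own s' next a s l hs h ih =>
    simp only [infosets, Finset.mem_insert, Finset.mem_biUnion, Finset.mem_univ, true_and]
    exact Or.inr ⟨a, ih⟩
  | other s' next a s l hs h ih =>
    simp only [infosets, Finset.mem_insert, Finset.mem_biUnion, Finset.mem_univ, true_and]
    exact Or.inr ⟨a, ih⟩

end Regret

/-! ### Regret matching -/

section RegretMatching

variable {S : Type u} {A : S → Type v} [∀ s, Fintype (A s)]

theorem inv_card_mem_stdSimplex {ι : Type*} [Fintype ι] [Nonempty ι] :
    (fun _ => 1 / (Fintype.card ι : ℝ)) ∈ stdSimplex ℝ ι := by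
  refine ⟨fun _ => by positivity, ?_⟩
  simp

theorem isProfile_uniform [∀ s, Nonempty (A s)] : IsProfile (uniform : ∀ s, A s → ℝ) :=
  fun _ => inv_card_mem_stdSimplex

theorem isProfile_regretMatching [∀ s, Nonempty (A s)] (R : ∀ s, A s → ℝ) :
    IsProfile (regretMatching R) := by
  intro s
  unfold regretMatching
  by_cases h : 0 < ∑ b, max 0 (R s b)
  · simp only [if_pos h]
    exact ⟨fun a => div_nonneg (le_max_left _ _) h.le, by rw [← Finset.sum_div, div_self h.ne']⟩
  · simp only [if_neg h]
    exact inv_card_mem_stdSimplex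

/-- The Blackwell condition: regret matching makes the next regret vector orthogonal to the positive
part of the cumulative regrets. -/
theorem sum_max_mul_eq_zero (R : ∀ s, A s → ℝ) (s : S) {r : A s → ℝ}
    (hr : ∑ a, regretMatching R s a * r a = 0) : ∑ a, max 0 (R s a) * r a = 0 := by
  by_cases h : 0 < ∑ b, max 0 (R s b)
  · simp only [regretMatching, if_pos h] at hr
    rw [← mul_eq_zero_iff_left (inv_ne_zero h.ne'), Finset.mul_sum]
    exact (Finset.sum_congr rfl fun a _ => by ring).trans hr
  · have h0 : ∑ b, max 0 (R s b) = 0 :=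
      le_antisymm (not_lt.1 h) (Finset.sum_nonneg fun a _ => le_max_left _ _)
    rw [Finset.sum_eq_zero_iff_of_nonneg fun a _ => le_max_left _ _] at h0
    exact Finset.sum_eq_zero fun a ha => by rw [h0 a ha, zero_mul]

theorem sq_max_zero_add_le (x y : ℝ) :
    max 0 (x + y) ^ 2 ≤ max 0 x ^ 2 + 2 * (max 0 x * y) + y ^ 2 := by
  have h1 : max 0 x ^ 2 + 2 * (max 0 x * y) + y ^ 2 = (max 0 x + y) ^ 2 := by ring
  rw [h1]
  rcases le_total (x + y) 0 with h | h
  · rw [max_eq_left h, zero_pow two_ne_zero]; exact sq_nonneg _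
  · rw [max_eq_right h]
    have := le_max_right 0 x
    exact pow_le_pow_left₀ h (by linarith) 2

variable [DecidableEq S] {owner : S → Fin 2} {i : Fin 2}

theorem isProfile_cfrStrategy [∀ s, Nonempty (A s)] (H : GameTree S A) (n : ℕ) :
    IsProfile (cfrStrategy owner H n) :=
  isProfile_regretMatching _

theorem cfrRegret_eq_sum (H : GameTree S A) (n : ℕ) (s : S) (a : A s) :
    cfrRegret owner H n s a =
      ∑ t ∈ Finset.range n, instRegret owner (cfrStrategy owner H t) s a H := by
  induction n with
  | zero => rfl
  | succ n ih => rw [Finset.sum_range_succ, ← ih]; rfl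

theorem sum_sq_cfrRegret_le [∀ s, Nonempty (A s)] {H : GameTree S A} (s : S) {D : ℝ}
    (hD : ∀ (a : A s) (π : ∀ s, A s → ℝ), IsProfile π → |instRegret owner π s a H| ≤ D)
    (n : ℕ) :
    ∑ a, max 0 (cfrRegret owner H n s a) ^ 2 ≤ n * (Fintype.card (A s) * D ^ 2) := by
  induction n with
  | zero => simp [cfrRegret]
  | succ n ih =>
    set π := cfrStrategy owner H n with hπdef
    have hπ : IsProfile π := isProfile_cfrStrategy H n
    have h0 := sum_max_mul_eq_zero (cfrRegret owner H n) s (sum_mul_instRegret (owner := owner) hπ s H)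
    have h1 : ∑ a, instRegret owner π s a H ^ 2 ≤ Fintype.card (A s) * D ^ 2 := by
      refine (Finset.sum_le_card_nsmul _ _ (D ^ 2) fun a _ => ?_).trans_eq ?_
      · exact sq_le_sq' (neg_le_of_abs_le (hD a π hπ)) (le_of_abs_le (hD a π hπ))
      · simp
    calc ∑ a, max 0 (cfrRegret owner H (n + 1) s a) ^ 2
        ≤ ∑ a, (max 0 (cfrRegret owner H n s a) ^ 2 +
            2 * (max 0 (cfrRegret owner H n s a) * instRegret owner π s a H) +
            instRegret owner π s a H ^ 2) :=
          Finset.sum_le_sum fun a _ => sq_max_zero_add_le _ _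
      _ = ∑ a, max 0 (cfrRegret owner H n s a) ^ 2 + ∑ a, instRegret owner π s a H ^ 2 := by
          rw [Finset.sum_add_distrib, Finset.sum_add_distrib, ← Finset.mul_sum, h0]; ring
      _ ≤ _ := by push_cast; linarith

theorem cfrRegret_le [∀ s, Nonempty (A s)] {H : GameTree S A} (hH : H.PerfectRecall owner)
    {lo hi : ℝ} (hlo : lo ≤ hi) (hp : H.payoffs ⊆ Set.Icc lo hi) (s : S) (a : A s) (n : ℕ) :
    cfrRegret owner H n s a ≤ (hi - lo) * √(n * Fintype.card (A s)) := by
  have hD : ∀ (a : A s) (π : ∀ s, A s → ℝ), IsProfile π →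
      |instRegret owner π s a H| ≤ hi - lo := by
    intro a π hπ
    by_cases h : ∃ l₀, Reaches owner (owner s) H s l₀
    · obtain ⟨l₀, hl₀⟩ := h
      exact abs_instRegret_le hπ hlo H hp (l₀ := l₀) fun l hl => hH s l l₀ hl hl₀
    · push Not at h
      rw [instRegret_eq_zero H h, abs_zero]
      exact sub_nonneg.2 hlo
  have h1 : max 0 (cfrRegret owner H n s a) ^ 2 ≤ n * (Fintype.card (A s) * (hi - lo) ^ 2) :=
    (Finset.single_le_sum (f := fun a => max 0 (cfrRegret owner H n s a) ^ 2)
      (fun _ _ => sq_nonneg _) (Finset.mem_univ a)).trans (sum_sq_cfrRegret_le s hD n)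
  refine (le_max_right 0 _).trans (abs_le_of_sq_le_sq' ?_ ?_).2
  · rw [mul_pow, Real.sq_sqrt (by positivity)]
    linarith
  · exact mul_nonneg (sub_nonneg.2 hlo) (Real.sqrt_nonneg _)

end RegretMatching

/-! ### Regret of counterfactual regret minimization -/

section CFR

variable {S : Type u} {A : S → Type v} [Fintype S] [DecidableEq S] [∀ s, Fintype (A s)]
  [∀ s, Nonempty (A s)] {owner : S → Fin 2}

theorem sum_gain_cfrStrategy_le {H : GameTree S A} (hH : H.PerfectRecall owner)
    {lo hi : ℝ} (hlo : lo ≤ hi) (hp : H.payoffs ⊆ Set.Icc lo hi) (i : Fin 2)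
    {σ : ∀ s, A s → ℝ} (hσ : IsProfile σ) (n : ℕ) :
    ∑ t ∈ Finset.range n, (H.util i (deviate owner i σ (cfrStrategy owner H t)) -
        H.util i (cfrStrategy owner H t)) ≤
      (hi - lo) * (H.numInfosets owner i * √(n * H.numActions owner i)) := by
  obtain ⟨W, hW⟩ := hH.exists_isOwnReach i
  obtain ⟨hWσ, hW01⟩ := hW σ hσ
  have hD : 0 ≤ hi - lo := sub_nonneg.2 hlo
  have h1 : ∀ t, H.util i (deviate owner i σ (cfrStrategy owner H t)) -
      H.util i (cfrStrategy owner H t) =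
      ∑ s with owner s = i, W σ s *
        ∑ a, σ s a * instRegret owner (cfrStrategy owner H t) s a H := by
    intro t
    rw [← mul_util_deviate_sub_util hσ H hWσ, one_mul]
  simp only [h1]
  rw [Finset.sum_comm]
  have h2 : ∀ s, ∑ t ∈ Finset.range n, W σ s *
      ∑ a, σ s a * instRegret owner (cfrStrategy owner H t) s a H =
      W σ s * ∑ a, σ s a * cfrRegret owner H n s a := by
    intro s
    rw [← Finset.mul_sum, Finset.sum_comm]
    simp only [cfrRegret_eq_sum, Finset.mul_sum]
  simp only [h2]
  have h3 : ∀ s ∈ Finset.univ.filter (fun s => owner s = i),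
      W σ s * ∑ a, σ s a * cfrRegret owner H n s a ≤
        if s ∈ H.infosets then (hi - lo) * √(n * H.numActions owner i) else 0 := by
    intro s hs
    have hs : owner s = i := (Finset.mem_filter.1 hs).2
    split_ifs with hmem
    · have hcard : Fintype.card (A s) ≤ H.numActions owner i :=
        Finset.le_sup (f := fun s => Fintype.card (A s)) (Finset.mem_filter.2 ⟨hmem, hs⟩)
      have hb : ∑ a, σ s a * cfrRegret owner H n s a ≤
          (hi - lo) * √(n * H.numActions owner i) := by
        calc ∑ a, σ s a * cfrRegret owner H n s a
            ≤ ∑ a, σ s a * ((hi - lo) * √(n * H.numActions owner i)) := by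
              refine Finset.sum_le_sum fun a _ => mul_le_mul_of_nonneg_left ?_ ((hσ s).1 a)
              refine (cfrRegret_le hH hlo hp s a n).trans ?_
              gcongr
          _ = _ := by rw [← Finset.sum_mul, (hσ s).2, one_mul]
      have hb0 : 0 ≤ (hi - lo) * √(n * H.numActions owner i) := by positivity
      calc W σ s * ∑ a, σ s a * cfrRegret owner H n s a
          ≤ W σ s * ((hi - lo) * √(n * H.numActions owner i)) :=
            mul_le_mul_of_nonneg_left hb (hW01 s).1
        _ ≤ _ := mul_le_of_le_one_left hb0 (hW01 s).2
    · have h0 : ∀ a, cfrRegret owner H n s a = 0 := fun a => by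
        rw [cfrRegret_eq_sum]
        exact Finset.sum_eq_zero fun t _ =>
          instRegret_eq_zero H fun l hl => hmem (mem_infosets_of_reaches hl)
      simp [h0]
  refine (Finset.sum_le_sum h3).trans_eq ?_
  rw [← Finset.sum_filter, Finset.sum_const, Finset.filter_filter, nsmul_eq_mul, numInfosets]
  have h4 : Finset.univ.filter (fun s => owner s = i ∧ s ∈ H.infosets) =
      H.infosets.filter fun s => owner s = i := by
    ext s; simp [and_comm]
  rw [h4]; ring

end CFR

/-! ### The average strategy -/

section Average

variable {S : Type u} {A : S → Type v} [∀ s, Fintype (A s)] {owner : S → Fin 2} {i : Fin 2}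

/-- If `ρ` averages the strategies `π t` with weights their own reach probabilities, then against
every opponent it earns what the strategies `π t` earn on average. -/
theorem sum_mul_value_deviate {ι : Type*} {T : Finset ι} {π : ι → ∀ s, A s → ℝ}
    {ρ τ : ∀ s, A s → ℝ} (H : GameTree S A) {c : ι → ℝ} {W : ι → S → ℝ}
    (hW : ∀ t ∈ T, IsOwnReach owner i (π t) H (c t) (W t))
    (hρ : ∀ s l, owner s = i → Reaches owner i H s l → ∀ a,
      (∑ t ∈ T, W t s) * ρ s a = ∑ t ∈ T, W t s * π t s a) :
    ∑ t ∈ T, c t * H.value (deviate owner i (π t) τ) =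
      (∑ t ∈ T, c t) * H.value (deviate owner i ρ τ) := by
  induction H generalizing c with
  | terminal r => simp [value, Finset.sum_mul]
  | chance n p next ih =>
    simp only [value, Finset.mul_sum]
    rw [Finset.sum_comm]
    refine Finset.sum_congr rfl fun j _ => ?_
    rw [mul_left_comm, ← ih j (fun t ht => (hW t ht).chance j)
      fun s l hs hl => hρ s l hs (.chance n p next j s l hl), Finset.mul_sum]
    exact Finset.sum_congr rfl fun t _ => by ring
  | decision s' next ih =>
    simp only [value, Finset.mul_sum]
    rw [Finset.sum_comm]
    refine Finset.sum_congr rfl fun b _ => ?_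
    by_cases h : owner s' = i
    · have h1 := ih b (fun t ht => (hW t ht).own h b)
        fun s l hs hl => hρ s _ hs (.own s' next b s l h hl)
      have h2 := hρ s' [] h (.here s' next) b
      have h4 : ∀ f : ι → ℝ, ∑ t ∈ T, W t s' * f t = ∑ t ∈ T, c t * f t :=
        fun f => Finset.sum_congr rfl fun t ht => by rw [(hW t ht).root h]
      rw [h4, Finset.sum_congr rfl fun t ht => (hW t ht).root h] at h2
      have h3 : ∀ μ : ∀ s, A s → ℝ, deviate owner i μ τ s' b = μ s' b := fun μ => by
        simp [deviate, h]
      simp only [h3, ← mul_assoc]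
      rw [h1, h2]
    · have h1 := ih b (fun t ht => (hW t ht).other h b)
        fun s l hs hl => hρ s _ hs (.other s' next b s l h hl)
      have h3 : ∀ μ : ∀ s, A s → ℝ, deviate owner i μ τ s' b = τ s' b := fun μ => by
        simp [deviate, h]
      simp only [h3]
      rw [mul_left_comm, ← h1, Finset.mul_sum]
      exact Finset.sum_congr rfl fun t _ => by ring

variable [DecidableEq S]

/-- The number of nodes of the tree that belong to the information set `s`. -/
def nodeCount (s : S) : GameTree S A → ℕ
  | terminal _ => 0
  | chance _ _ next => ∑ c, nodeCount s (next c)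
  | decision s' next => (if s = s' then 1 else 0) + ∑ b, nodeCount s (next b)

theorem nodeCount_pos_of_reaches {H : GameTree S A} {s : S} {l : List (Σ s, A s)}
    (h : Reaches owner i H s l) : 0 < nodeCount s H := by
  induction h with
  | here s next => simp [nodeCount]
  | chance n p next c s l h ih =>
    exact ih.trans_le (Finset.single_le_sum (f := fun c => nodeCount s (next c))
      (fun _ _ => Nat.zero_le _) (Finset.mem_univ c))
  | own s' next a s l hs h ih =>
    exact (ih.trans_le (Finset.single_le_sum (f := fun c => nodeCount s (next c))
      (fun _ _ => Nat.zero_le _) (Finset.mem_univ a))).trans_le (Nat.le_add_left _ _)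
  | other s' next a s l hs h ih =>
    exact (ih.trans_le (Finset.single_le_sum (f := fun c => nodeCount s (next c))
      (fun _ _ => Nat.zero_le _) (Finset.mem_univ a))).trans_le (Nat.le_add_left _ _)

theorem mul_ownReach {π : ∀ s, A s → ℝ} (s : S) (H : GameTree S A) {c : ℝ} {W : S → ℝ}
    (hW : IsOwnReach owner (owner s) π H c W) :
    c * ownReach owner π s H = nodeCount s H * W s := by
  induction H generalizing c with
  | terminal r => simp [ownReach, nodeCount]
  | chance n p next ih =>
    simp only [ownReach, nodeCount, Finset.mul_sum, Nat.cast_sum, Finset.sum_mul]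
    exact Finset.sum_congr rfl fun j _ => ih j (hW.chance j)
  | decision s' next ih =>
    simp only [ownReach, nodeCount, Nat.cast_add, Nat.cast_sum, mul_add, add_mul, Finset.mul_sum,
      Finset.sum_mul]
    congr 1
    · by_cases h : s = s'
      · subst h; simp [hW.root rfl]
      · simp [h]
    · refine Finset.sum_congr rfl fun b _ => ?_
      by_cases h : owner s' = owner s
      · rw [if_pos h, ← mul_assoc, ih b (hW.own h b)]
      · rw [if_neg h, one_mul, ih b (hW.other h b)]

theorem ownReach_nonneg {π : ∀ s, A s → ℝ} (hπ : IsProfile π) (s : S) (H : GameTree S A) :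
    0 ≤ ownReach owner π s H := by
  induction H with
  | terminal r => exact le_rfl
  | chance n p next ih => exact Finset.sum_nonneg fun j _ => ih j
  | decision s' next ih =>
    refine add_nonneg (by split_ifs <;> norm_num) (Finset.sum_nonneg fun b _ => ?_)
    refine mul_nonneg ?_ (ih b)
    split_ifs
    exacts [(hπ s').1 b, zero_le_one]

theorem isProfile_cfrAverage [∀ s, Nonempty (A s)] (H : GameTree S A) (n : ℕ) :
    IsProfile (cfrAverage owner H n) := by
  intro s
  have hw : ∀ t, 0 ≤ ownReach owner (cfrStrategy owner H t) s H :=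
    fun t => ownReach_nonneg (isProfile_cfrStrategy H t) s H
  unfold cfrAverage
  by_cases h : 0 < ∑ t ∈ Finset.range n, ownReach owner (cfrStrategy owner H t) s H
  · simp only [if_pos h]
    refine ⟨fun a => div_nonneg (Finset.sum_nonneg fun t _ =>
      mul_nonneg (hw t) ((isProfile_cfrStrategy H t s).1 a)) h.le, ?_⟩
    rw [← Finset.sum_div, Finset.sum_comm]
    simp only [← Finset.mul_sum, (isProfile_cfrStrategy H _ s).2, mul_one]
    exact div_self h.ne'
  · simp only [if_neg h]
    exact inv_card_mem_stdSimplex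

theorem sum_value_deviate_cfrStrategy [∀ s, Nonempty (A s)] {H : GameTree S A}
    (hH : H.PerfectRecall owner) (i : Fin 2) (τ : ∀ s, A s → ℝ) (n : ℕ) :
    ∑ t ∈ Finset.range n, H.value (deviate owner i (cfrStrategy owner H t) τ) =
      n * H.value (deviate owner i (cfrAverage owner H n) τ) := by
  obtain ⟨W, hW⟩ := hH.exists_isOwnReach i
  have hWt := fun t => (hW _ (isProfile_cfrStrategy (owner := owner) H t)).1
  have h := sum_mul_value_deviate (T := Finset.range n) (ρ := cfrAverage owner H n) (τ := τ) H
    (fun t _ => hWt t) ?_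
  · simpa using h
  · intro s l hs hl a
    subst hs
    have hN : (0 : ℝ) < nodeCount s H := by exact_mod_cast nodeCount_pos_of_reaches hl
    have hR : ∀ t, ownReach owner (cfrStrategy owner H t) s H =
        nodeCount s H * W (cfrStrategy owner H t) s :=
      fun t => by rw [← mul_ownReach s H (hWt t), one_mul]
    simp only [cfrAverage, hR, mul_assoc, ← Finset.mul_sum]
    split_ifs with hpos
    · rw [mul_div_mul_left _ _ hN.ne', mul_div_cancel₀]
      exact (pos_of_mul_pos_right hpos hN.le).ne'
    · have h0 : ∀ t, 0 ≤ W (cfrStrategy owner H t) s :=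
        fun t => ((hW _ (isProfile_cfrStrategy H t)).2 s).1
      have h1 : ∑ t ∈ Finset.range n, W (cfrStrategy owner H t) s = 0 := by
        refine le_antisymm (not_lt.1 fun hlt => hpos (mul_pos hN hlt))
          (Finset.sum_nonneg fun t _ => h0 t)
      rw [h1, zero_mul]
      rw [Finset.sum_eq_zero_iff_of_nonneg fun t _ => h0 t] at h1
      exact (Finset.sum_eq_zero fun t ht => by rw [h1 t ht, zero_mul]).symm

end Average

/-! ### Exploitability -/

section Exploitability

theorem deviate_zero_eq {S : Type u} {A : S → Type v} {owner : S → Fin 2}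
    (σ π : ∀ s, A s → ℝ) : deviate owner 0 σ π = deviate owner 1 π σ := by
  funext s
  have h : owner s = 0 ∨ owner s = 1 := by omega
  rcases h with h | h <;> simp [deviate, h]

variable {S : Type u} {A : S → Type v} [∀ s, Fintype (A s)] {owner : S → Fin 2}

theorem util_one_eq (H : GameTree S A) (π : ∀ s, A s → ℝ) : H.util 1 π = - H.util 0 π := by
  simp [util, sign]

theorem bddAbove_gains {π : ∀ s, A s → ℝ} (hπ : IsProfile π) (H : GameTree S A) :
    BddAbove (Set.range fun σ : {σ : ∀ s, A s → ℝ // IsProfile σ} =>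
      ∑ i, (H.util i (deviate owner i σ.1 π) - H.util i π)) := by
  obtain ⟨lo, hlo⟩ := H.exists_payoffs_subset_Icc
  refine ⟨∑ _ : Fin 2, (lo + H.payoffRange - lo), ?_⟩
  rintro _ ⟨σ, rfl⟩
  exact Finset.sum_le_sum fun i _ =>
    le_of_abs_le (abs_util_sub_util_le (σ.2.deviate hπ) hπ hlo hlo i)

theorem gain_le_exploitability {π σ : ∀ s, A s → ℝ} (hπ : IsProfile π) (hσ : IsProfile σ)
    (H : GameTree S A) (i : Fin 2) :
    H.util i (deviate owner i σ π) - H.util i π ≤ H.exploitability owner π := by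
  -- only player `i` deviates
  have h := le_ciSup (bddAbove_gains (owner := owner) hπ H) ⟨deviate owner i σ π, hσ.deviate hπ⟩
  refine le_trans (le_of_eq ?_) h
  rw [Finset.sum_eq_single i]
  · congr 2
    funext s
    by_cases hs : owner s = i <;> simp [deviate, hs]
  · intro j _ hj
    have : deviate owner j (deviate owner i σ π) π = π := by
      funext s
      by_cases hs : owner s = j
      · simp [deviate, hs, hj]
      · simp [deviate, hs]
    simp only [this, sub_self]
  · simp

/-- In a zero-sum game a bound on the gains of all deviations suffices: what the opponent's deviation
costs a player is what it earns the opponent. -/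
theorem isNash_of_gain_le {H : GameTree S A} {π : ∀ s, A s → ℝ} (hπ : IsProfile π) {ε : ℝ}
    (h : ∀ i σ, IsProfile σ → H.util i (deviate owner i σ π) - H.util i π ≤ ε) :
    H.IsNash owner ε π := by
  refine ⟨hπ, fun i σ hσ => ⟨?_, by linarith [h i σ hσ]⟩⟩
  have hi : i = 0 ∨ i = 1 := by omega
  rcases hi with rfl | rfl
  · have := h 1 σ hσ
    rw [← deviate_zero_eq, util_one_eq, util_one_eq] at this
    linarith
  · have := h 0 σ hσ
    rw [deviate_zero_eq] at this
    rw [util_one_eq, util_one_eq]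
    linarith

variable [Fintype S] [DecidableEq S] [∀ s, Nonempty (A s)]

/-- The number `max_i |S_i|² |A_i|`, which governs the rate of convergence of CFR. -/
def cfrScale (owner : S → Fin 2) (H : GameTree S A) : ℕ :=
  Finset.univ.sup fun i : Fin 2 => H.numInfosets owner i ^ 2 * H.numActions owner i

/-- CFR drives the exploitability of the average strategy below `δ` within
`4 D² max_i |S_i|² |A_i| / δ²` iterations. -/
theorem exploitability_cfrAverage_le {H : GameTree S A} (hH : H.PerfectRecall owner)
    {lo hi : ℝ} (hlo : lo ≤ hi) (hp : H.payoffs ⊆ Set.Icc lo hi) {n : ℕ} (hn : 0 < n) {δ : ℝ}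
    (hδ : 0 ≤ δ) (h : 4 * (hi - lo) ^ 2 * H.cfrScale owner ≤ n * δ ^ 2) :
    H.exploitability owner (cfrAverage owner H n) ≤ δ := by
  have : Nonempty {σ : ∀ s, A s → ℝ // IsProfile σ} := ⟨⟨_, isProfile_uniform⟩⟩
  refine ciSup_le fun σ => ?_
  have hn' : (0 : ℝ) < n := by exact_mod_cast hn
  have hD : 0 ≤ hi - lo := sub_nonneg.2 hlo
  set π := cfrAverage owner H n
  have h0 := sum_value_deviate_cfrStrategy hH 0 σ.1 n
  have h1 := sum_value_deviate_cfrStrategy hH 1 σ.1 n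
  have key : n * ∑ i, (H.util i (deviate owner i σ.1 π) - H.util i π) =
      ∑ i, ∑ t ∈ Finset.range n, (H.util i (deviate owner i σ.1 (cfrStrategy owner H t)) -
        H.util i (cfrStrategy owner H t)) := by
    simp only [Fin.sum_univ_two, Finset.sum_sub_distrib, util_one_eq, Finset.sum_neg_distrib]
    simp only [deviate_zero_eq σ.1, ← deviate_zero_eq _ σ.1]
    simp only [util, sign, if_true, one_mul, h0, h1]
    ring
  have hbound : ∀ i, ∑ t ∈ Finset.range n,
      (H.util i (deviate owner i σ.1 (cfrStrategy owner H t)) -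
        H.util i (cfrStrategy owner H t)) ≤ n * (δ / 2) := by
    intro i
    refine (sum_gain_cfrStrategy_le hH hlo hp i σ.2 n).trans (abs_le_of_sq_le_sq' ?_ ?_).2
    · have hs : H.numInfosets owner i ^ 2 * H.numActions owner i ≤ H.cfrScale owner :=
        Finset.le_sup (f := fun i : Fin 2 => H.numInfosets owner i ^ 2 * H.numActions owner i)
          (Finset.mem_univ i)
      have hs' : (H.numInfosets owner i : ℝ) ^ 2 * H.numActions owner i ≤ H.cfrScale owner := by
        exact_mod_cast hs
      have e : ((hi - lo) * (H.numInfosets owner i * √(n * H.numActions owner i))) ^ 2 =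
          n * ((hi - lo) ^ 2 * (H.numInfosets owner i ^ 2 * H.numActions owner i)) := by
        rw [mul_pow, mul_pow, Real.sq_sqrt (by positivity)]; ring
      rw [e, mul_pow, pow_two (n : ℝ), mul_assoc]
      refine mul_le_mul_of_nonneg_left ?_ hn'.le
      have := mul_le_mul_of_nonneg_left hs' (sq_nonneg (hi - lo))
      linarith
    · positivity
  have h2 : n * ∑ i, (H.util i (deviate owner i σ.1 π) - H.util i π) ≤ n * δ := by
    rw [key, Fin.sum_univ_two]
    linarith [hbound 0, hbound 1]
  exact le_of_mul_le_mul_left h2 hn'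

end Exploitability

end GameTree

/-! ### Restricted games -/

namespace Population

open GameTree

section Restrict

variable {S : Type u} {A : S → Type v}

instance (P : Population A) (s : S) : Nonempty (P.acts s) := (P.nonempty s).to_subtype

theorem payoffs_restrict_subset (P : Population A) (G : GameTree S A) :
    (P.restrict G).payoffs ⊆ G.payoffs := by
  induction G with
  | terminal r => exact le_rfl
  | chance n p next ih => exact Set.iUnion_mono ih
  | decision s next ih =>
    exact Set.iUnion_subset fun a =>
      (ih a).trans (Set.subset_iUnion (fun a => (next a).payoffs) a.1)

theorem reaches_of_restrict {owner : S → Fin 2} {i : Fin 2} {P : Population A} {G : GameTree S A}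
    {s : S} {l : List (Σ s, P.acts s)} (h : Reaches owner i (P.restrict G) s l) :
    Reaches owner i G s (l.map fun x => ⟨x.1, x.2.1⟩) := by
  induction G generalizing l with
  | terminal r => nomatch h
  | chance n p next ih =>
    cases h with
    | chance _ _ _ c _ _ h => exact .chance n p next c s _ (ih c h)
  | decision s' next ih =>
    cases h with
    | here => exact .here s next
    | own _ _ a _ l hs h => exact .own s' next a.1 s _ hs (ih a.1 h)
    | other _ _ a _ l hs h => exact .other s' next a.1 s _ hs (ih a.1 h)

theorem perfectRecall_restrict {owner : S → Fin 2} {G : GameTree S A}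
    (hG : G.PerfectRecall owner) (P : Population A) : (P.restrict G).PerfectRecall owner := by
  intro s l l' hl hl'
  have h := hG s _ _ (reaches_of_restrict hl) (reaches_of_restrict hl')
  refine List.map_injective_iff.2 ?_ h
  rintro ⟨s₁, a₁, h₁⟩ ⟨s₂, a₂, h₂⟩ he
  simp only [Sigma.mk.injEq] at he
  obtain ⟨rfl, he⟩ := he
  obtain rfl := eq_of_heq he
  rfl

variable [∀ s, DecidableEq (A s)]

theorem add_eq_iff {P : Population A} {b : ∀ s, A s} :
    P.add b = P ↔ ∀ s, b s ∈ P.acts s := by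
  constructor
  · intro h s
    rw [← h]
    exact Finset.mem_insert_self _ _
  · intro h
    ext s : 2
    exact Finset.insert_eq_of_mem (h s)

theorem isProfile_extend [∀ s, Fintype (A s)] (P : Population A) {π : ∀ s, P.acts s → ℝ}
    (hπ : IsProfile π) : IsProfile (P.extend π) := by
  intro s
  refine ⟨fun a => ?_, ?_⟩
  · unfold extend
    split_ifs with h
    exacts [(hπ s).1 _, le_rfl]
  · have h1 : ∑ a, P.extend π s a = ∑ a ∈ P.acts s, P.extend π s a :=
      (Finset.sum_subset (Finset.subset_univ _) fun a _ ha => by simp [extend, ha]).symm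
    rw [h1, ← Finset.sum_coe_sort, ← (hπ s).2]
    exact Finset.sum_congr rfl fun a _ => by simp [extend]

theorem value_extend [∀ s, Fintype (A s)] (P : Population A) (π : ∀ s, P.acts s → ℝ)
    (G : GameTree S A) : G.value (P.extend π) = (P.restrict G).value π := by
  induction G with
  | terminal r => rfl
  | chance n p next ih => exact Finset.sum_congr rfl fun c _ => by rw [ih]
  | decision s next ih =>
    simp only [value, restrict]
    have h1 : ∑ a, P.extend π s a * (next a).value (P.extend π) =
        ∑ a ∈ P.acts s, P.extend π s a * (next a).value (P.extend π) :=
      (Finset.sum_subset (Finset.subset_univ _) fun a _ ha => by simp [extend, ha]).symm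
    rw [h1, ← Finset.sum_coe_sort]
    exact Finset.sum_congr rfl fun a _ => by rw [ih]; simp [extend]

theorem deviate_extend (owner : S → Fin 2) (i : Fin 2) (P : Population A)
    (σ π : ∀ s, P.acts s → ℝ) :
    deviate owner i (P.extend σ) (P.extend π) = P.extend (deviate owner i σ π) := by
  funext s a
  by_cases h : owner s = i <;> simp [deviate, extend, h]

/-- If best responses against `π` are available in the restricted game, then `π` is as close to
equilibrium in the whole game as in the restricted game. -/
theorem isNash_extend [∀ s, Fintype (A s)] {owner : S → Fin 2} {G : GameTree S A}
    {β : Fin 2 → (∀ s, A s → ℝ) → ∀ s, A s} (hβ : DoubleOracle.IsOracle owner G β)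
    (P : Population A) {π : ∀ s, P.acts s → ℝ} (hπ : IsProfile π) {ε : ℝ}
    (hmem : ∀ s, DoubleOracle.jointResponse owner β (P.extend π) s ∈ P.acts s)
    (hε : (P.restrict G).exploitability owner π ≤ ε) :
    G.IsNash owner ε (P.extend π) := by
  refine isNash_of_gain_le (P.isProfile_extend hπ) fun i σ hσ => ?_
  set b : ∀ s, P.acts s :=
    fun s => ⟨DoubleOracle.jointResponse owner β (P.extend π) s, hmem s⟩ with hb
  have hbr := hβ i _ (P.isProfile_extend hπ) σ hσ
  have hpure : IsProfile (GameTree.pure b) := by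
    intro s
    refine ⟨fun a => by unfold GameTree.pure; split_ifs <;> norm_num, ?_⟩
    simp [GameTree.pure]
  have heq : deviate owner i (GameTree.pure (β i (P.extend π))) (P.extend π) =
      P.extend (deviate owner i (GameTree.pure b) π) := by
    rw [← deviate_extend]
    funext s a
    by_cases h : owner s = i
    · by_cases ha : a ∈ P.acts s
      · simp [deviate, extend, h, ha, GameTree.pure, hb, DoubleOracle.jointResponse]
      · have : a ≠ β i (P.extend π) s := by
          rintro rfl
          apply ha
          have := hmem s
          rwa [DoubleOracle.jointResponse, h] at this
        simp [deviate, extend, h, ha, GameTree.pure, this]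
    · simp [deviate, h]
  rw [heq] at hbr
  have h1 := gain_le_exploitability (owner := owner) hπ hpure (P.restrict G) i
  simp only [util, value_extend] at hbr h1 ⊢
  linarith

end Restrict

section Size

variable {S : Type u} {A : S → Type v} [DecidableEq S] {owner : S → Fin 2}

theorem infosets_restrict_mono {P Q : Population A} (h : ∀ s, P.acts s ⊆ Q.acts s)
    (G : GameTree S A) : (P.restrict G).infosets ⊆ (Q.restrict G).infosets := by
  induction G with
  | terminal r => exact subset_rfl
  | chance n p next ih =>
    intro s hs
    simp only [restrict, infosets, Finset.mem_biUnion, Finset.mem_univ, true_and] at hs ⊢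
    exact hs.imp fun c hc => ih c hc
  | decision s' next ih =>
    intro s hs
    simp only [restrict, infosets, Finset.mem_insert, Finset.mem_biUnion, Finset.mem_univ,
      true_and] at hs ⊢
    exact hs.imp_right fun ⟨a, ha⟩ => ⟨⟨a.1, h s' a.2⟩, ih a.1 ha⟩

theorem size_restrict_mono {P Q : Population A} (h : ∀ s, P.acts s ⊆ Q.acts s)
    (G : GameTree S A) : (P.restrict G).size owner ≤ (Q.restrict G).size owner :=
  Finset.sum_le_sum fun _ _ =>
    Finset.card_le_card (Finset.filter_subset_filter _ (infosets_restrict_mono h G))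

theorem infosets_restrict_nonempty [∀ s, Fintype (A s)] {G : GameTree S A}
    (hG : G.infosets.Nonempty) (P : Population A) : (P.restrict G).infosets.Nonempty := by
  induction G with
  | terminal r => exact hG
  | chance n p next ih =>
    obtain ⟨s, hs⟩ := hG
    simp only [infosets, Finset.mem_biUnion, Finset.mem_univ, true_and] at hs
    obtain ⟨c, hc⟩ := hs
    obtain ⟨s', hs'⟩ := ih c ⟨s, hc⟩
    refine ⟨s', ?_⟩
    simp only [restrict, infosets, Finset.mem_biUnion, Finset.mem_univ, true_and]
    exact ⟨c, hs'⟩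
  | decision s' next ih => exact ⟨s', Finset.mem_insert_self _ _⟩

end Size

end Population

namespace GameTree

section Size

variable {S : Type u} {A : S → Type v} [DecidableEq S] [∀ s, Fintype (A s)] {owner : S → Fin 2}

theorem card_le_maxActions {H : GameTree S A} {s : S} (hs : s ∈ H.infosets) :
    Fintype.card (A s) ≤ H.maxActions owner :=
  (Finset.le_sup (f := fun s => Fintype.card (A s))
    (Finset.mem_filter (p := fun s' => owner s' = owner s) |>.2 ⟨hs, rfl⟩)).trans
    (Finset.le_sup (f := fun i => H.numActions owner i) (Finset.mem_univ (owner s)))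

theorem numInfosets_le_size (H : GameTree S A) (i : Fin 2) :
    H.numInfosets owner i ≤ H.size owner :=
  Finset.single_le_sum (f := fun i => H.numInfosets owner i) (fun _ _ => Nat.zero_le _)
    (Finset.mem_univ i)

theorem size_eq_card_infosets (H : GameTree S A) : H.size owner = H.infosets.card := by
  rw [size, Finset.card_eq_sum_card_fiberwise (f := owner) (t := Finset.univ)
    fun _ _ => Finset.mem_univ _]
  rfl

theorem cfrScale_restrict_le {G : GameTree S A} (hG : ∀ s, s ∈ G.infosets) (P : Population A) :
    (P.restrict G).cfrScale owner ≤ G.maxActions owner * (P.restrict G).size owner ^ 2 := by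
  refine Finset.sup_le fun i _ => ?_
  rw [mul_comm]
  refine Nat.mul_le_mul (Finset.sup_le fun s _ => ?_)
    (Nat.pow_le_pow_left (numInfosets_le_size _ i) 2)
  refine le_trans ?_ (card_le_maxActions (owner := owner) (hG s))
  exact Fintype.card_le_of_injective _ Subtype.val_injective

theorem maxActions_pos_of_size_pos [∀ s, Nonempty (A s)] {G : GameTree S A}
    (hall : ∀ s, s ∈ G.infosets) {P : Population A}
    (h : 0 < (P.restrict G).size owner) : 0 < G.maxActions owner := by
  rw [size_eq_card_infosets, Finset.card_pos] at h
  obtain ⟨s, -⟩ := h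
  exact Fintype.card_pos.trans_le (card_le_maxActions (owner := owner) (hall s))

theorem one_le_cfrScale [∀ s, Nonempty (A s)] {H : GameTree S A} (hH : H.infosets.Nonempty) :
    1 ≤ H.cfrScale owner := by
  obtain ⟨s, hs⟩ := hH
  have h1 : 1 ≤ H.numInfosets owner (owner s) :=
    Finset.card_pos.2 ⟨s, Finset.mem_filter.2 ⟨hs, rfl⟩⟩
  have h2 : 1 ≤ H.numActions owner (owner s) :=
    Fintype.card_pos.trans_le
      (Finset.le_sup (f := fun s => Fintype.card (A s)) (Finset.mem_filter.2 ⟨hs, rfl⟩))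
  exact (Nat.mul_pos (pow_pos h1 2) h2).trans_le
    (Finset.le_sup (f := fun i => H.numInfosets owner i ^ 2 * H.numActions owner i)
      (Finset.mem_univ (owner s)))

end Size

end GameTree

/-! ### The states of a run -/

namespace DoubleOracle

open GameTree

section Run

variable {S : Type u} {A : S → Type v} [DecidableEq S] [∀ s, DecidableEq (A s)]
  {owner : S → Fin 2} {G : GameTree S A} {β : Fin 2 → (∀ s, A s → ℝ) → ∀ s, A s}

variable [∀ s, Fintype (A s)] {call : ℕ → State A → Prop}

theorem run_succ_of_changed {t : ℕ} (h : call (t + 1) (run owner G β call t) ∧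
      enlarged owner G β (run owner G β call t) ≠ (run owner G β call t).pop) :
    run owner G β call (t + 1) =
      { win := (run owner G β call t).win + 1
        pop := enlarged owner G β (run owner G β call t)
        iters := 0 } :=
  if_pos h

theorem run_succ_of_not_changed {t : ℕ} (h : ¬ (call (t + 1) (run owner G β call t) ∧
      enlarged owner G β (run owner G β call t) ≠ (run owner G β call t).pop)) :
    run owner G β call (t + 1) =
      { run owner G β call t with iters := (run owner G β call t).iters + 1 } :=
  if_neg h

/-- An iteration either starts a new window or continues the current one. -/
theorem run_succ_cases (owner : S → Fin 2) (G : GameTree S A)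
    (β : Fin 2 → (∀ s, A s → ℝ) → ∀ s, A s) (call : ℕ → State A → Prop) (t : ℕ) :
    (call (t + 1) (run owner G β call t) ∧
      enlarged owner G β (run owner G β call t) ≠ (run owner G β call t).pop ∧
      run owner G β call (t + 1) =
        { win := (run owner G β call t).win + 1
          pop := enlarged owner G β (run owner G β call t)
          iters := 0 }) ∨
    ((call (t + 1) (run owner G β call t) →
        enlarged owner G β (run owner G β call t) = (run owner G β call t).pop) ∧
      run owner G β call (t + 1) =
        { run owner G β call t with iters := (run owner G β call t).iters + 1 }) := by
  by_cases h : call (t + 1) (run owner G β call t) ∧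
      enlarged owner G β (run owner G β call t) ≠ (run owner G β call t).pop
  · exact Or.inl ⟨h.1, h.2, run_succ_of_changed h⟩
  · exact Or.inr ⟨fun hc => by_contra fun hne => h ⟨hc, hne⟩, run_succ_of_not_changed h⟩

theorem acts_run_subset {t t' : ℕ} (h : t ≤ t') (s : S) :
    (run owner G β call t).pop.acts s ⊆ (run owner G β call t').pop.acts s := by
  induction t', h using Nat.le_induction with
  | base => exact subset_rfl
  | succ t' _ ih =>
    refine ih.trans ?_
    rcases run_succ_cases owner G β call t' with ⟨_, _, h⟩ | ⟨_, h⟩ <;> rw [h]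
    exact Finset.subset_insert _ _

theorem restrictedSize_run_mono {t t' : ℕ} (h : t ≤ t') :
    restrictedSize owner G (run owner G β call t) ≤
      restrictedSize owner G (run owner G β call t') :=
  Population.size_restrict_mono (fun s => acts_run_subset h s) G

theorem win_run_le_sum_card [Fintype S] (t : ℕ) :
    (run owner G β call t).win ≤ ∑ s, ((run owner G β call t).pop.acts s).card := by
  induction t with
  | zero => exact Nat.zero_le _
  | succ t ih =>
    rcases run_succ_cases owner G β call t with ⟨_, hne, h⟩ | ⟨_, h⟩ <;> rw [h]
    · have hne' := mt Population.add_eq_iff.2 hne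
      push Not at hne'
      obtain ⟨s, hs⟩ := hne'
      refine Nat.succ_le_of_lt (ih.trans_lt ?_)
      refine Finset.sum_lt_sum (fun s' _ => Finset.card_le_card (Finset.subset_insert _ _))
        ⟨s, Finset.mem_univ s, Finset.card_lt_card (Finset.ssubset_insert hs)⟩
    · exact ih

theorem win_run_le [Fintype S] (t : ℕ) :
    (run owner G β call t).win ≤ ∑ s, Fintype.card (A s) :=
  (win_run_le_sum_card t).trans (Finset.sum_le_sum fun _ _ => Finset.card_le_univ _)

/-- If no window `j` has more than `L j` iterations, then the windows up to the current one have at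
most `∑ j, L j` iterations. -/
theorem time_le_sum {L : ℕ → ℝ} {t : ℕ}
    (h : ∀ τ ≤ t, ((run owner G β call τ).iters + 1 : ℝ) ≤ L (run owner G β call τ).win) :
    (t + 1 : ℝ) ≤ ∑ j ∈ Finset.range ((run owner G β call t).win + 1), L j := by
  have h1 : (t : ℝ) ≤ ∑ j ∈ Finset.range (run owner G β call t).win, L j +
      (run owner G β call t).iters := by
    induction t with
    | zero => simp [run]
    | succ t ih =>
      have ih := ih fun τ hτ => h τ (hτ.trans (Nat.le_succ t))
      have ht := h t (Nat.le_succ t)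
      rcases run_succ_cases owner G β call t with ⟨_, hne, h⟩ | ⟨_, h⟩ <;> rw [h] <;> push_cast
      · rw [Finset.sum_range_succ]; linarith
      · linarith
  rw [Finset.sum_range_succ]
  linarith [h t le_rfl]

/-- The states of the current window differ only in the number of iterations, and no call of the
oracle in the window has changed the population. -/
theorem run_sub (t d : ℕ) (hd : d ≤ (run owner G β call t).iters) :
    d ≤ t ∧ run owner G β call (t - d) =
      { run owner G β call t with iters := (run owner G β call t).iters - d } := by
  induction t generalizing d with
  | zero =>
    obtain rfl : d = 0 := Nat.le_zero.1 hd
    exact ⟨le_rfl, rfl⟩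
  | succ t ih =>
    cases d with
    | zero => exact ⟨Nat.zero_le _, rfl⟩
    | succ d =>
      rcases run_succ_cases owner G β call t with ⟨_, _, h⟩ | ⟨_, h⟩ <;> rw [h] at hd ⊢
      · simp at hd
      · obtain ⟨h1, h2⟩ := ih d (Nat.le_of_succ_le_succ hd)
        exact ⟨Nat.succ_le_succ h1, by rw [Nat.add_sub_add_right, h2]; simp⟩

theorem samples_le [Fintype S] (T : ℕ) : samples owner G β call (T + 1) ≤
    2 * restrictedSize owner G (run owner G β call T) * (T + 1) := by
  classical
  refine (Finset.sum_le_card_nsmul _ _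
    (2 * restrictedSize owner G (run owner G β call T)) fun τ hτ => ?_).trans_eq ?_
  · have := restrictedSize_run_mono (owner := owner) (G := G) (β := β) (call := call)
      (Nat.lt_succ_iff.1 (Finset.mem_range.1 hτ))
    split_ifs <;> omega
  · simp [mul_comm]

end Run

/-! ### Convergence within a window -/

section Window

variable {S : Type u} {A : S → Type v} [DecidableEq S] [∀ s, Fintype (A s)] {owner : S → Fin 2}
  {G : GameTree S A} {β : Fin 2 → (∀ s, A s → ℝ) → ∀ s, A s}

theorem exploitability_restrict_cfrAverage_le [Fintype S] (hG : G.PerfectRecall owner)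
    (P : Population A) {n : ℕ} (hn : 0 < n) {δ : ℝ} (hδ : 0 ≤ δ)
    (h : 4 * G.payoffRange ^ 2 * (P.restrict G).cfrScale owner ≤ n * δ ^ 2) :
    (P.restrict G).exploitability owner ((P.restrict G).cfrAverage owner n) ≤ δ := by
  obtain ⟨lo, hlo⟩ := G.exists_payoffs_subset_Icc
  refine exploitability_cfrAverage_le (P.perfectRecall_restrict hG)
    (le_add_of_nonneg_right G.payoffRange_nonneg) ((P.payoffs_restrict_subset G).trans hlo) hn hδ ?_
  rwa [add_sub_cancel_left]

variable [∀ s, DecidableEq (A s)]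

theorem isNash_windowAverage (hβ : IsOracle owner G β) {x : State A}
    (hx : enlarged owner G β x = x.pop) {ε : ℝ}
    (hε : (x.pop.restrict G).exploitability owner (localAverage owner G x) ≤ ε) :
    G.IsNash owner ε (windowAverage owner G x) :=
  x.pop.isNash_extend hβ (isProfile_cfrAverage _ _) (Population.add_eq_iff.1 hx) hε

variable [Fintype S]

/-- In a run of RMDO that has not met an `ε`-equilibrium, the current window `j` consists of at most
`m j` iterations after its last call of the oracle, and that call came before CFR had brought the
exploitability in the restricted game down to `ε`. -/
theorem iters_rmdo_le (hG : G.PerfectRecall owner) (hβ : IsOracle owner G β) {clock : Clock}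
    {m : ℕ → Population A → ℕ} (hm : ∀ j P, 0 < m j P) {ε : ℝ} (hε : 0 < ε) {t : ℕ}
    (ht : ∀ τ < t, ¬ G.IsNash owner ε (windowAverage owner G (run owner G β (rmdo clock m) τ))) :
    ((run owner G β (rmdo clock m) t).iters + 1 : ℝ) ≤
      m (run owner G β (rmdo clock m) t).win (run owner G β (rmdo clock m) t).pop +
      4 * G.payoffRange ^ 2 *
        ((run owner G β (rmdo clock m) t).pop.restrict G).cfrScale owner / ε ^ 2 := by
  set x := run owner G β (rmdo clock m) t with hx
  set M := m x.win x.pop with hM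
  have hMpos : 0 < M := hm _ _
  have hnn : 0 ≤ 4 * G.payoffRange ^ 2 * ((x.pop.restrict G).cfrScale owner : ℝ) / ε ^ 2 := by
    positivity
  by_cases hlt : x.iters < M
  · have : (x.iters + 1 : ℝ) ≤ M := by exact_mod_cast hlt
    linarith
  · push Not at hlt
    -- the last call of the oracle happened `d` iterations ago
    have hit : x.iters ≤ t := (run_sub t x.iters le_rfl).1
    obtain ⟨d, hd1, hdM, hcall⟩ : ∃ d, 1 ≤ d ∧ d ≤ M ∧
        rmdo clock m (t - d + 1) { x with iters := x.iters - d } := by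
      cases clock with
      | total =>
        have := Nat.mod_lt t hMpos
        refine ⟨t % M + 1, Nat.le_add_left _ _, this, ?_⟩
        have e : t - (t % M + 1) + 1 = t - t % M := by omega
        simp only [rmdo, e]
        exact Nat.dvd_sub_mod t
      | window =>
        have := Nat.mod_lt x.iters hMpos
        refine ⟨x.iters % M + 1, Nat.le_add_left _ _, this, ?_⟩
        have e : x.iters - (x.iters % M + 1) + 1 = x.iters - x.iters % M := by omega
        simp only [rmdo, e]
        exact Nat.dvd_sub_mod x.iters
    obtain ⟨hdt, hrun⟩ := run_sub (owner := owner) (G := G) (β := β) (call := rmdo clock m) t d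
      (hdM.trans hlt)
    obtain ⟨-, hrun'⟩ := run_sub (owner := owner) (G := G) (β := β) (call := rmdo clock m) t (d - 1)
      ((Nat.sub_le d 1).trans (hdM.trans hlt))
    rw [← hx] at hrun hrun'
    have hsucc : t - (d - 1) = t - d + 1 := by omega
    rw [hsucc] at hrun'
    have hc : rmdo clock m (t - d + 1) (run owner G β (rmdo clock m) (t - d)) := by
      rw [hrun]; exact hcall
    have hsame : enlarged owner G β (run owner G β (rmdo clock m) (t - d)) =
        (run owner G β (rmdo clock m) (t - d)).pop := by
      rcases run_succ_cases owner G β (rmdo clock m) (t - d) with ⟨_, _, h⟩ | ⟨h, _⟩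
      · rw [hrun', hrun] at h
        have := congrArg State.win h
        simp at this
      · exact h hc
    have hnot := fun h => ht (t - d) (by omega) (isNash_windowAverage hβ hsame (ε := ε) h)
    have hlast : ((x.iters - d + 1 : ℕ) : ℝ) * ε ^ 2 <
        4 * G.payoffRange ^ 2 * (x.pop.restrict G).cfrScale owner := by
      by_contra hge
      apply hnot
      rw [localAverage, hrun]
      exact exploitability_restrict_cfrAverage_le hG x.pop (Nat.succ_pos _) hε.le (not_lt.1 hge)
    have h1 : ((x.iters - d + 1 : ℕ) : ℝ) ≤
        4 * G.payoffRange ^ 2 * (x.pop.restrict G).cfrScale owner / ε ^ 2 := by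
      rw [le_div_iff₀ (by positivity)]; exact hlast.le
    have h2 : (x.iters + 1 : ℝ) ≤ M + ((x.iters - d + 1 : ℕ) : ℝ) := by
      have : x.iters + 1 ≤ M + (x.iters - d + 1) := by omega
      exact_mod_cast this
    linarith

end Window

/-! ### Sample complexity of RMDO -/

section Frequency

variable {S : Type u} {A : S → Type v} [DecidableEq S]

theorem xdoFrequency_pos (owner : S → Fin 2) (G : GameTree S A) (ε₀ : ℝ) (j : ℕ)
    (P : Population A) : 0 < xdoFrequency owner G ε₀ j P :=
  Nat.lt_of_lt_of_le one_pos (le_max_left _ _)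

theorem le_xdoFrequency (owner : S → Fin 2) (G : GameTree S A) (ε₀ : ℝ) (j : ℕ)
    (P : Population A) :
    4 ^ j * ((P.restrict G).cfrScale owner : ℝ) / ε₀ ^ 2 ≤ xdoFrequency owner G ε₀ j P :=
  (Nat.le_ceil _).trans (Nat.cast_le.2 (le_max_right _ _))

theorem max_one_ceil_le {x : ℝ} (hx : 0 ≤ x) : ((max 1 ⌈x⌉₊ : ℕ) : ℝ) ≤ x + 1 := by
  rw [Nat.cast_max, Nat.cast_one]
  exact max_le (by linarith) (Nat.ceil_lt_add_one hx).le

theorem xdoFrequency_le (owner : S → Fin 2) (G : GameTree S A) (ε₀ : ℝ) (j : ℕ)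
    (P : Population A) :
    (xdoFrequency owner G ε₀ j P : ℝ) ≤
      4 ^ j * ((P.restrict G).cfrScale owner : ℝ) / ε₀ ^ 2 + 1 :=
  max_one_ceil_le (by positivity)

end Frequency

section Complexity

/-- A bound on the number of iterations of the window `j` of RMDO before the accuracy `ε` is reached,
where `M` bounds `max_i |S_i|² |A_i|` and `K` is `max 1 Δ²`: the first part is the period between two
calls of the oracle, the second one the time that CFR needs to reach the accuracy `ε`. -/
noncomputable def windowBound (K M ε ε₀ : ℝ) (j : ℕ) : ℝ :=
  4 * K * (4 ^ j * M / ε₀ ^ 2) + 1 + 4 * K * M / ε ^ 2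

theorem sum_windowBound_le {K M ε ε₀ : ℝ} (hK : 0 ≤ K) (hM : 0 ≤ M) (k : ℕ) :
    ∑ j ∈ Finset.range k, windowBound K M ε ε₀ j ≤
      4 * K * (4 ^ k * M / ε₀ ^ 2) + k * (1 + 4 * K * M / ε ^ 2) := by
  induction k with
  | zero => simp; positivity
  | succ k ih =>
    rw [Finset.sum_range_succ]
    have h : 0 ≤ 4 * K * (4 ^ k * M / ε₀ ^ 2) := by positivity
    have e : 4 * K * (4 ^ (k + 1) * M / ε₀ ^ 2) = 4 * (4 * K * (4 ^ k * M / ε₀ ^ 2)) := by ring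
    rw [e, windowBound]
    push_cast
    linarith

variable {S : Type u} {A : S → Type v} [DecidableEq S] [∀ s, Fintype (A s)]
  [∀ s, DecidableEq (A s)] {owner : S → Fin 2} {G : GameTree S A}
  {β : Fin 2 → (∀ s, A s → ℝ) → ∀ s, A s}

/-- The window before the current one took at least as many iterations as its frequency. -/
theorem le_samples_rmdo_window [∀ s, Nonempty (A s)] (hall : ∀ s, s ∈ G.infosets)
    {m : ℕ → Population A → ℕ} {T : ℕ} (hT : 1 ≤ (run owner G β (rmdo .window m) T).win) :
    ∃ P : Population A, (P.restrict G).infosets.Nonempty ∧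
      m ((run owner G β (rmdo .window m) T).win - 1) P ≤
        samples owner G β (rmdo .window m) (T + 1) := by
  classical
  have hex : ∃ τ ≤ T, ∃ P : Population A, (∃ s : S, s ∈ G.infosets) ∧
      m ((run owner G β (rmdo .window m) T).win - 1) P ≤ τ := by
    induction T with
    | zero => simp [run] at hT
    | succ T ih =>
      rcases run_succ_cases owner G β (rmdo .window m) T with ⟨hc, hne, h⟩ | ⟨_, h⟩
      · have hne' := mt Population.add_eq_iff.2 hne
        push Not at hne'
        obtain ⟨s, -⟩ := hne'
        refine ⟨T + 1, le_rfl, (run owner G β (rmdo .window m) T).pop, ⟨s, hall s⟩, ?_⟩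
        rw [h]
        exact (Nat.le_of_dvd (Nat.succ_pos _) hc).trans
          (Nat.succ_le_succ (run_sub T _ le_rfl).1)
      · rw [h] at hT ⊢
        obtain ⟨τ, hτ, hP⟩ := ih hT
        exact ⟨τ, hτ.trans (Nat.le_succ T), hP⟩
  obtain ⟨τ, hτ, P, hs, hP⟩ := hex
  refine ⟨P, Population.infosets_restrict_nonempty hs P, hP.trans (hτ.trans ?_)⟩
  have h1 : ∀ x : State A, 1 ≤ restrictedSize owner G x := fun x => by
    rw [restrictedSize, size_eq_card_infosets]
    exact Finset.card_pos.2 (Population.infosets_restrict_nonempty hs x.pop)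
  calc T ≤ T + 1 := Nat.le_succ T
    _ = ∑ _τ ∈ Finset.range (T + 1), 1 := by simp
    _ ≤ _ := Finset.sum_le_sum fun τ _ => (h1 _).trans (Nat.le_add_right _ _)

variable [Fintype S]

/-- The time before the accuracy `ε` is reached, summed over the windows; restricted games only grow,
so the size `X` of the last one serves for all of them. -/
theorem time_rmdo_le (hG : G.PerfectRecall owner) (hall : ∀ s, s ∈ G.infosets)
    (hβ : IsOracle owner G β) {clock : Clock} {m : ℕ → Population A → ℕ} {ε ε₀ : ℝ}
    (hm : ∀ j P, 0 < m j P ∧ (m j P : ℝ) ≤ 4 * max 1 (G.payoffRange ^ 2) *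
      (4 ^ j * ((P.restrict G).cfrScale owner : ℝ) / ε₀ ^ 2) + 1)
    (hε : 0 < ε) {T X : ℕ}
    (hT : ∀ τ < T, ¬ G.IsNash owner ε (windowAverage owner G (run owner G β (rmdo clock m) τ)))
    (hX : restrictedSize owner G (run owner G β (rmdo clock m) T) ≤ X) :
    (T + 1 : ℝ) ≤ ∑ j ∈ Finset.range ((run owner G β (rmdo clock m) T).win + 1),
      windowBound (max 1 (G.payoffRange ^ 2)) (G.maxActions owner * X ^ 2) ε ε₀ j := by
  refine time_le_sum fun τ hτ => ?_
  refine (iters_rmdo_le hG hβ (fun j P => (hm j P).1) hε fun τ' hτ' =>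
    hT τ' (hτ'.trans_le hτ)).trans ?_
  set x := run owner G β (rmdo clock m) τ
  have hM : ((x.pop.restrict G).cfrScale owner : ℝ) ≤ G.maxActions owner * (X : ℝ) ^ 2 := by
    have h1 := cfrScale_restrict_le (owner := owner) hall x.pop
    have h2 : (x.pop.restrict G).size owner ≤ X := (restrictedSize_run_mono hτ).trans hX
    exact_mod_cast h1.trans (Nat.mul_le_mul_left _ (Nat.pow_le_pow_left h2 2))
  have hK : G.payoffRange ^ 2 ≤ max 1 (G.payoffRange ^ 2) := le_max_right _ _
  refine add_le_add ((hm _ _).2.trans ?_) ?_ <;> gcongr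

/-- A frequency function of at most the order of `xdoFrequency` gives RMDO the sample complexity
`xdoBound`. -/
theorem exists_reachesWithin_rmdo [∀ s, Nonempty (A s)] (hG : G.PerfectRecall owner)
    (hall : ∀ s, s ∈ G.infosets) (hβ : IsOracle owner G β) (clock : Clock)
    {m : ℕ → Population A → ℕ} {ε ε₀ : ℝ}
    (hm : ∀ j P, 0 < m j P ∧ (m j P : ℝ) ≤ 4 * max 1 (G.payoffRange ^ 2) *
      (4 ^ j * ((P.restrict G).cfrScale owner : ℝ) / ε₀ ^ 2) + 1)
    (hε : 0 < ε) (hεD : ε ≤ G.payoffRange) :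
    ∃ T, ReachesWithin owner G β (rmdo clock m) (10 * max 1 (G.payoffRange ^ 2)) ε ε₀ T := by
  set K := max 1 (G.payoffRange ^ 2) with hKdef
  have hK1 : 1 ≤ K := le_max_left _ _
  have hK0 : 0 ≤ K := zero_le_one.trans hK1
  -- the number of windows is bounded, hence so is the time without an equilibrium
  have hex : ∃ t, G.IsNash owner ε (windowAverage owner G (run owner G β (rmdo clock m) t)) := by
    by_contra hno
    push Not at hno
    set B := ∑ j ∈ Finset.range ((∑ s, Fintype.card (A s)) + 1),
      windowBound K (G.maxActions owner * (Fintype.card S : ℕ) ^ 2) ε ε₀ j with hB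
    obtain ⟨T, hT⟩ := exists_nat_gt B
    have h1 := time_rmdo_le (T := T) (X := Fintype.card S) hG hall hβ hm hε (fun τ _ => hno τ)
      (by rw [restrictedSize, size_eq_card_infosets]; exact Finset.card_le_univ _)
    have h2 : ∑ j ∈ Finset.range ((run owner G β (rmdo clock m) T).win + 1),
        windowBound K (G.maxActions owner * (Fintype.card S : ℕ) ^ 2) ε ε₀ j ≤ B := by
      refine Finset.sum_le_sum_of_subset_of_nonneg ?_ fun j _ _ => ?_
      · exact Finset.range_subset_range.2 (Nat.succ_le_succ (win_run_le T))
      · unfold windowBound; positivity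
    linarith
  classical
  refine ⟨Nat.find hex, ⟨Nat.find_spec hex, fun t ht => Nat.find_min' hex ht⟩, ?_⟩
  set T := Nat.find hex
  set x := run owner G β (rmdo clock m) T with hx
  set X := restrictedSize owner G x with hX
  have htime := time_rmdo_le hG hall hβ hm hε (fun τ hτ => Nat.find_min hex hτ) hX.ge
  replace htime := htime.trans (sum_windowBound_le hK0 (by positivity) _)
  have hs : (samples owner G β (rmdo clock m) (T + 1) : ℝ) ≤ 2 * X * (T + 1) := by
    exact_mod_cast samples_le (owner := owner) (G := G) (β := β) (call := rmdo clock m) T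
  rw [← hx] at htime
  set k := x.win + 1
  set a := G.maxActions owner
  refine hs.trans ((mul_le_mul_of_nonneg_left htime (by positivity)).trans ?_)
  -- the rounding of the periods costs at most `k X`, since `ε ≤ Δ`
  have hone : (X : ℝ) ≤ K * (a * X ^ 3 / ε ^ 2) := by
    rcases Nat.eq_zero_or_pos X with h0 | hpos
    · simp [h0]
    · have ha : (1 : ℝ) ≤ a := by exact_mod_cast maxActions_pos_of_size_pos hall hpos
      have hX1 : (1 : ℝ) ≤ X := by exact_mod_cast hpos
      have hεK : 1 ≤ K / ε ^ 2 := by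
        rw [one_le_div (by positivity)]
        exact (pow_le_pow_left₀ hε.le hεD 2).trans (le_max_right _ _)
      have h3 : (X : ℝ) ≤ a * X ^ 3 := by
        have : (X : ℝ) ≤ X ^ 3 := le_self_pow₀ hX1 (by norm_num)
        nlinarith
      calc (X : ℝ) ≤ a * X ^ 3 := h3
        _ ≤ K / ε ^ 2 * (a * X ^ 3) := le_mul_of_one_le_left (by positivity) hεK
        _ = _ := by ring
  have hk : (k : ℝ) * X ≤ k * (K * (a * X ^ 3 / ε ^ 2)) :=
    mul_le_mul_of_nonneg_left hone (by positivity)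
  have hp : 0 ≤ K * (a * X ^ 3 * 4 ^ k / ε₀ ^ 2) := by positivity
  rw [xdoBound]
  have e1 : 2 * (X : ℝ) * (4 * K * (4 ^ k * (a * X ^ 2) / ε₀ ^ 2) +
      k * (1 + 4 * K * (a * X ^ 2) / ε ^ 2)) =
      8 * (K * (a * X ^ 3 * 4 ^ k / ε₀ ^ 2)) + 2 * (k * X) +
        8 * (k * (K * (a * X ^ 3 / ε ^ 2))) := by ring
  have e2 : 10 * K * (k * a * X ^ 3 / ε ^ 2 + a * X ^ 3 * 4 ^ k / ε₀ ^ 2) =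
      10 * (k * (K * (a * X ^ 3 / ε ^ 2))) + 10 * (K * (a * X ^ 3 * 4 ^ k / ε₀ ^ 2)) := by ring
  rw [e1, e2]
  linarith

end Complexity

/-! ### XDO as an instance of RMDO -/

section XDO

variable {S : Type u} {A : S → Type v} [DecidableEq S]

/-- The first iteration of window `j` with population `P` after which the exploitability in the
restricted game is at most the threshold `ε₀ / 2 ^ j`. -/
noncomputable def xdoPeriod (owner : S → Fin 2) (G : GameTree S A) (ε₀ : ℝ) (j : ℕ)
    (P : Population A) : ℕ :=
  sInf {n | 0 < n ∧
    (P.restrict G).exploitability owner ((P.restrict G).cfrAverage owner n) ≤ ε₀ / 2 ^ j}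

theorem xdoPeriod_le_of_exploitability_le {owner : S → Fin 2} {G : GameTree S A} {ε₀ : ℝ} {j : ℕ}
    {P : Population A} {n : ℕ} (hn : 0 < n)
    (h : (P.restrict G).exploitability owner ((P.restrict G).cfrAverage owner n) ≤ ε₀ / 2 ^ j) :
    xdoPeriod owner G ε₀ j P ≤ n :=
  Nat.sInf_le ⟨hn, h⟩

variable [Fintype S] [∀ s, Fintype (A s)] {owner : S → Fin 2} {G : GameTree S A}

theorem xdoPeriod_spec (hG : G.PerfectRecall owner) {ε₀ : ℝ} (hε₀ : 0 < ε₀) (j : ℕ)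
    (P : Population A) :
    0 < xdoPeriod owner G ε₀ j P ∧
    (P.restrict G).exploitability owner
      ((P.restrict G).cfrAverage owner (xdoPeriod owner G ε₀ j P)) ≤ ε₀ / 2 ^ j ∧
    (xdoPeriod owner G ε₀ j P : ℝ) ≤ 4 * max 1 (G.payoffRange ^ 2) *
      (4 ^ j * ((P.restrict G).cfrScale owner : ℝ) / ε₀ ^ 2) + 1 := by
  set x : ℝ := 4 * max 1 (G.payoffRange ^ 2) *
      (4 ^ j * ((P.restrict G).cfrScale owner : ℝ) / ε₀ ^ 2) with hx
  have hx0 : 0 ≤ x := by positivity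
  set n := max 1 ⌈x⌉₊ with hn
  have hn0 : 0 < n := Nat.lt_of_lt_of_le one_pos (le_max_left _ _)
  have hmem : n ∈ {n | 0 < n ∧ (P.restrict G).exploitability owner
      ((P.restrict G).cfrAverage owner n) ≤ ε₀ / 2 ^ j} := by
    refine ⟨hn0, exploitability_restrict_cfrAverage_le hG P hn0 (by positivity) ?_⟩
    have h1 : x ≤ n := (Nat.le_ceil x).trans (Nat.cast_le.2 (le_max_right _ _))
    have e : x * (ε₀ / 2 ^ j) ^ 2 =
        4 * max 1 (G.payoffRange ^ 2) * (P.restrict G).cfrScale owner := by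
      have h4 : (4 : ℝ) ^ j = (2 ^ j) ^ 2 := by rw [← pow_mul, mul_comm, pow_mul]; norm_num
      rw [hx, h4]; field_simp
    calc 4 * G.payoffRange ^ 2 * ((P.restrict G).cfrScale owner : ℝ)
        ≤ 4 * max 1 (G.payoffRange ^ 2) * (P.restrict G).cfrScale owner := by
          gcongr; exact le_max_right _ _
      _ = x * (ε₀ / 2 ^ j) ^ 2 := e.symm
      _ ≤ n * (ε₀ / 2 ^ j) ^ 2 := by gcongr
  have hspec := Nat.sInf_mem ⟨n, hmem⟩
  exact ⟨hspec.1, hspec.2, (Nat.cast_le.2 (Nat.sInf_le hmem)).trans (max_one_ceil_le hx0)⟩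

/-- XDO calls the oracle for the first time in a window exactly after `xdoPeriod` iterations. -/
theorem xdo_iff_rmdo (hG : G.PerfectRecall owner) {ε₀ : ℝ} (hε₀ : 0 < ε₀) {x : State A}
    (hx : x.iters + 1 ≤ xdoPeriod owner G ε₀ x.win x.pop) (t : ℕ) :
    xdo owner G ε₀ t x ↔ rmdo .window (xdoPeriod owner G ε₀) t x := by
  constructor
  · intro h
    exact (hx.antisymm (xdoPeriod_le_of_exploitability_le (Nat.succ_pos _) h)).symm.dvd
  · intro h
    have e := hx.antisymm (Nat.le_of_dvd (Nat.succ_pos _) h)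
    rw [xdo, localAverage, e]
    exact (xdoPeriod_spec hG hε₀ _ _).2.1

variable [∀ s, DecidableEq (A s)] {β : Fin 2 → (∀ s, A s → ℝ) → ∀ s, A s}

/-- As long as XDO does not stop, every call of the oracle starts a new window, so that the first
call of a window is its last iteration. -/
theorem iters_xdo_le (hG : G.PerfectRecall owner) {ε₀ : ℝ} (hε₀ : 0 < ε₀) {t : ℕ}
    (ht : ∀ τ < t, ¬ ConvergedAt owner G β (xdo owner G ε₀) τ) :
    (run owner G β (xdo owner G ε₀) t).iters + 1 ≤
      xdoPeriod owner G ε₀ (run owner G β (xdo owner G ε₀) t).win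
        (run owner G β (xdo owner G ε₀) t).pop := by
  induction t with
  | zero => exact (xdoPeriod_spec hG hε₀ _ _).1
  | succ t ih =>
    have ih := ih fun τ hτ => ht τ (hτ.trans (Nat.lt_succ_self t))
    rcases run_succ_cases owner G β (xdo owner G ε₀) t with ⟨_, _, h⟩ | ⟨hc, h⟩
    · rw [h]
      exact (xdoPeriod_spec hG hε₀ _ _).1
    · rw [h]
      refine Nat.succ_le_of_lt (lt_of_le_of_ne ih fun e => ?_)
      have hcall : xdo owner G ε₀ (t + 1) (run owner G β (xdo owner G ε₀) t) :=
        (xdo_iff_rmdo hG hε₀ ih _).2 e.symm.dvd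
      exact ht t (Nat.lt_succ_self t) ⟨hcall, hc hcall⟩

theorem exists_convergedAt_xdo (hG : G.PerfectRecall owner) (hall : ∀ s, s ∈ G.infosets)
    {ε₀ : ℝ} (hε₀ : 0 < ε₀) : ∃ t, ConvergedAt owner G β (xdo owner G ε₀) t := by
  by_contra hno
  push Not at hno
  set L : ℕ → ℝ := fun j => 4 * max 1 (G.payoffRange ^ 2) *
    (4 ^ j * (G.maxActions owner * (Fintype.card S : ℝ) ^ 2) / ε₀ ^ 2) + 1 with hL
  obtain ⟨T, hT⟩ := exists_nat_gt (∑ j ∈ Finset.range ((∑ s, Fintype.card (A s)) + 1), L j)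
  have h1 := time_le_sum (owner := owner) (G := G) (β := β) (call := xdo owner G ε₀) (L := L)
    (t := T) fun τ _ => by
      have h := iters_xdo_le (t := τ) (β := β) hG hε₀ fun τ _ => hno τ
      set x := run owner G β (xdo owner G ε₀) τ
      have h' : (x.iters + 1 : ℝ) ≤ xdoPeriod owner G ε₀ x.win x.pop := by exact_mod_cast h
      refine h'.trans ((xdoPeriod_spec hG hε₀ _ _).2.2.trans ?_)
      have hM : ((x.pop.restrict G).cfrScale owner : ℝ) ≤
          G.maxActions owner * (Fintype.card S : ℝ) ^ 2 := by
        have h1 := cfrScale_restrict_le (owner := owner) hall x.pop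
        have h2 : (x.pop.restrict G).size owner ≤ Fintype.card S := by
          rw [size_eq_card_infosets]; exact Finset.card_le_univ _
        exact_mod_cast h1.trans (Nat.mul_le_mul_left _ (Nat.pow_le_pow_left h2 2))
      simp only [hL]
      gcongr
  have h2 : ∑ j ∈ Finset.range ((run owner G β (xdo owner G ε₀) T).win + 1), L j ≤
      ∑ j ∈ Finset.range ((∑ s, Fintype.card (A s)) + 1), L j := by
    refine Finset.sum_le_sum_of_subset_of_nonneg ?_ fun j _ _ => ?_
    · exact Finset.range_subset_range.2 (Nat.succ_le_succ (win_run_le T))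
    · simp only [hL]; positivity
  linarith

theorem run_xdo_eq_run_rmdo (hG : G.PerfectRecall owner) {ε₀ : ℝ} (hε₀ : 0 < ε₀) {t : ℕ}
    (ht : ∀ τ < t, ¬ ConvergedAt owner G β (xdo owner G ε₀) τ) :
    run owner G β (xdo owner G ε₀) t =
      run owner G β (rmdo .window (xdoPeriod owner G ε₀)) t := by
  induction t with
  | zero => rfl
  | succ t ih =>
    have ht' := fun τ (hτ : τ < t) => ht τ (hτ.trans (Nat.lt_succ_self t))
    have hiff := xdo_iff_rmdo hG hε₀ (iters_xdo_le hG hε₀ ht') (t + 1)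
    rw [run, run, ← ih ht', propext hiff]

end XDO

end DoubleOracle

/-! ### Sample complexity of XDO -/

theorem mainTheorem2 :
    ∃ C : ℝ, 0 < C ∧
      ∀ (S : Type u) (A : S → Type v) [Fintype S] [DecidableEq S] [∀ s, Fintype (A s)]
        [∀ s, DecidableEq (A s)] [∀ s, Nonempty (A s)]
        (owner : S → Fin 2) (G : GameTree S A),
        G.PerfectRecall owner → (∀ s, s ∈ G.infosets) →
      ∀ (β : Fin 2 → (∀ s, A s → ℝ) → ∀ s, A s), DoubleOracle.IsOracle owner G β →
      ∀ ε₀ : ℝ, 0 < ε₀ →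
        -- XDO converges, say in iteration `N + 1`
        (∃ N : ℕ,
          IsLeast {t | DoubleOracle.ConvergedAt owner G β (DoubleOracle.xdo owner G ε₀) t} N ∧
          -- the output is an `ε₀ / 2 ^ (k - 1)`-equilibrium, with `k` the number of windows
          G.IsNash owner
            (ε₀ / 2 ^ (DoubleOracle.run owner G β (DoubleOracle.xdo owner G ε₀) N).win)
            (DoubleOracle.windowAverage owner G
              (DoubleOracle.run owner G β (DoubleOracle.xdo owner G ε₀) N)) ∧
          -- XDO is an instance of RMDO
          (∃ m : ℕ → Population A → ℕ,
            -- in the worst case, its frequency function is `xdoFrequency`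
            (∀ j P, 0 < m j P ∧
              (m j P : ℝ) ≤
                C * max 1 (G.payoffRange ^ 2) * DoubleOracle.xdoFrequency owner G ε₀ j P) ∧
            -- same states and same best-response calls until XDO stops
            (∀ t ≤ N,
              DoubleOracle.run owner G β (DoubleOracle.xdo owner G ε₀) t =
                DoubleOracle.run owner G β (DoubleOracle.rmdo .window m) t ∧
              (DoubleOracle.xdo owner G ε₀ (t + 1)
                  (DoubleOracle.run owner G β (DoubleOracle.xdo owner G ε₀) t) ↔
                DoubleOracle.rmdo .window m (t + 1)
                  (DoubleOracle.run owner G β (DoubleOracle.rmdo .window m) t))) ∧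
            -- sample complexity of this instance, for every accuracy
            ∀ ε : ℝ, 0 < ε → ε ≤ G.payoffRange →
              ∃ T, DoubleOracle.ReachesWithin owner G β (DoubleOracle.rmdo .window m)
                (C * max 1 (G.payoffRange ^ 2)) ε ε₀ T) ∧
          -- sample complexity of XDO, for every accuracy that its last threshold warrants
          ∀ ε : ℝ, 0 < ε → ε ≤ G.payoffRange →
            ε₀ / 2 ^ (DoubleOracle.run owner G β (DoubleOracle.xdo owner G ε₀) N).win ≤ ε →
            ∃ T ≤ N, DoubleOracle.ReachesWithin owner G β (DoubleOracle.xdo owner G ε₀)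
              (C * max 1 (G.payoffRange ^ 2)) ε ε₀ T) ∧
        -- sample complexity of RMDO with the worst-case frequency function of XDO
        (∀ (clock : DoubleOracle.Clock) (ε : ℝ), 0 < ε → ε ≤ G.payoffRange →
          ∃ T, DoubleOracle.ReachesWithin owner G β
            (DoubleOracle.rmdo clock (DoubleOracle.xdoFrequency owner G ε₀))
            (C * max 1 (G.payoffRange ^ 2)) ε ε₀ T) ∧
        -- with that frequency function the sample count is exponential in the number `k` of windows
        (∀ T : ℕ,
          1 ≤ (DoubleOracle.run owner G β
            (DoubleOracle.rmdo .window (DoubleOracle.xdoFrequency owner G ε₀)) T).win →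
          (4 : ℝ) ^ ((DoubleOracle.run owner G β
              (DoubleOracle.rmdo .window (DoubleOracle.xdoFrequency owner G ε₀)) T).win + 1)
              / (16 * ε₀ ^ 2) ≤
            DoubleOracle.samples owner G β
              (DoubleOracle.rmdo .window (DoubleOracle.xdoFrequency owner G ε₀)) (T + 1)) := by
  -- `8` for the sum over the windows at two samples per information set and iteration, `2` for the
  -- rounding of the frequencies
  refine ⟨10, by norm_num, ?_⟩
  intro S A _ _ _ _ _ owner G hG hall β hβ ε₀ hε₀
  refine ⟨?_, ?_, ?_⟩
  · classical
    have hex := DoubleOracle.exists_convergedAt_xdo (β := β) hG hall hε₀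
    set N := Nat.find hex with hN
    have hbefore : ∀ t ≤ N, ∀ τ < t,
        ¬ DoubleOracle.ConvergedAt owner G β (DoubleOracle.xdo owner G ε₀) τ :=
      fun t ht τ hτ => Nat.find_min hex (hτ.trans_le ht)
    have hspec : DoubleOracle.ConvergedAt owner G β (DoubleOracle.xdo owner G ε₀) N :=
      Nat.find_spec hex
    have hnash : G.IsNash owner
        (ε₀ / 2 ^ (DoubleOracle.run owner G β (DoubleOracle.xdo owner G ε₀) N).win)
        (DoubleOracle.windowAverage owner G
          (DoubleOracle.run owner G β (DoubleOracle.xdo owner G ε₀) N)) :=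
      DoubleOracle.isNash_windowAverage hβ hspec.2 hspec.1
    set m := DoubleOracle.xdoPeriod owner G ε₀ with hm
    have hrun : ∀ t ≤ N, DoubleOracle.run owner G β (DoubleOracle.xdo owner G ε₀) t =
        DoubleOracle.run owner G β (DoubleOracle.rmdo .window m) t :=
      fun t ht => DoubleOracle.run_xdo_eq_run_rmdo hG hε₀ (hbefore t ht)
    have hcall : ∀ t ≤ N, (DoubleOracle.xdo owner G ε₀ (t + 1)
          (DoubleOracle.run owner G β (DoubleOracle.xdo owner G ε₀) t) ↔
        DoubleOracle.rmdo .window m (t + 1)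
          (DoubleOracle.run owner G β (DoubleOracle.rmdo .window m) t)) := fun t ht => by
      rw [← hrun t ht]
      exact DoubleOracle.xdo_iff_rmdo hG hε₀ (DoubleOracle.iters_xdo_le hG hε₀ (hbefore t ht)) _
    have hreach : ∀ ε : ℝ, 0 < ε → ε ≤ G.payoffRange →
        ∃ T, DoubleOracle.ReachesWithin owner G β (DoubleOracle.rmdo .window m)
          (10 * max 1 (G.payoffRange ^ 2)) ε ε₀ T := fun ε hε hεD =>
      DoubleOracle.exists_reachesWithin_rmdo hG hall hβ .window
        (fun j P => ⟨(DoubleOracle.xdoPeriod_spec hG hε₀ j P).1,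
          (DoubleOracle.xdoPeriod_spec hG hε₀ j P).2.2⟩) hε hεD
    refine ⟨N, ⟨hspec, fun t ht => Nat.find_min' hex ht⟩, hnash,
      ⟨m, fun j P => ⟨(DoubleOracle.xdoPeriod_spec hG hε₀ j P).1, ?_⟩,
        fun t ht => ⟨hrun t ht, hcall t ht⟩, hreach⟩, ?_⟩
    · have h1 := (DoubleOracle.xdoPeriod_spec hG hε₀ j P).2.2
      have h2 := DoubleOracle.le_xdoFrequency owner G ε₀ j P
      have h3 : (1 : ℝ) ≤ DoubleOracle.xdoFrequency owner G ε₀ j P := by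
        exact_mod_cast DoubleOracle.xdoFrequency_pos owner G ε₀ j P
      have hK : (1 : ℝ) ≤ max 1 (G.payoffRange ^ 2) := le_max_left _ _
      refine h1.trans ?_
      nlinarith [mul_le_mul_of_nonneg_left h2 (zero_le_one.trans hK),
        mul_le_mul hK h3 zero_le_one (zero_le_one.trans hK)]
    · intro ε hε hεD hεN
      obtain ⟨T, hT, hsamples⟩ := hreach ε hε hεD
      -- the output of XDO is an `ε`-equilibrium, so the first one is not later
      have hNmem : G.IsNash owner ε (DoubleOracle.windowAverage owner G
          (DoubleOracle.run owner G β (DoubleOracle.rmdo .window m) N)) := by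
        rw [← hrun N le_rfl]
        refine ⟨hnash.1, fun i σ hσ => ?_⟩
        have := hnash.2 i σ hσ
        exact ⟨by linarith [this.1], by linarith [this.2]⟩
      have hTN : T ≤ N := hT.2 hNmem
      refine ⟨T, hTN, ⟨?_, fun t ht => ?_⟩, ?_⟩
      · have h := hT.1
        rwa [Set.mem_ofPred_eq, ← hrun T hTN] at h
      · rcases le_total t N with h | h
        · apply hT.2
          rw [Set.mem_ofPred_eq] at ht ⊢
          rwa [← hrun t h]
        · exact hTN.trans h
      · have hs : DoubleOracle.samples owner G β (DoubleOracle.xdo owner G ε₀) (T + 1) =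
            DoubleOracle.samples owner G β (DoubleOracle.rmdo .window m) (T + 1) := by
          refine Finset.sum_congr rfl fun τ hτ => ?_
          have hτN : τ ≤ N := (Nat.lt_succ_iff.1 (Finset.mem_range.1 hτ)).trans hTN
          rw [propext (hcall τ hτN), hrun τ hτN]
        rw [hs, hrun T hTN]
        exact hsamples
  · intro clock ε hε hεD
    refine DoubleOracle.exists_reachesWithin_rmdo hG hall hβ clock
      (fun j P => ⟨DoubleOracle.xdoFrequency_pos owner G ε₀ j P, ?_⟩) hε hεD
    refine (DoubleOracle.xdoFrequency_le owner G ε₀ j P).trans ?_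
    have hK : (1 : ℝ) ≤ max 1 (G.payoffRange ^ 2) := le_max_left _ _
    have h0 : 0 ≤ 4 ^ j * ((P.restrict G).cfrScale owner : ℝ) / ε₀ ^ 2 := by positivity
    nlinarith
  · intro T hT
    obtain ⟨P, hP, hle⟩ := DoubleOracle.le_samples_rmdo_window hall hT
    set w := (DoubleOracle.run owner G β
      (DoubleOracle.rmdo .window (DoubleOracle.xdoFrequency owner G ε₀)) T).win with hw
    obtain ⟨j, hj⟩ : ∃ j, w = j + 1 := ⟨w - 1, by omega⟩
    rw [hj, Nat.add_sub_cancel] at hle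
    have h1 : (1 : ℝ) ≤ (P.restrict G).cfrScale owner := by
      exact_mod_cast GameTree.one_le_cfrScale (owner := owner) hP
    calc (4 : ℝ) ^ (w + 1) / (16 * ε₀ ^ 2) = 4 ^ j * 1 / ε₀ ^ 2 := by
          rw [hj]; field_simp; ring
      _ ≤ 4 ^ j * ((P.restrict G).cfrScale owner : ℝ) / ε₀ ^ 2 := by gcongr
      _ ≤ DoubleOracle.xdoFrequency owner G ε₀ j P := DoubleOracle.le_xdoFrequency owner G ε₀ j P
      _ ≤ _ := by exact_mod_cast hle
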